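/- For $s\in\mathbf{C}$ write $s=\sigma+it$ with $\sigma,t$ real. Let \[R(s)=\int_{0\swarrow1}\frac{x^{-s}e^{\pi i x^2}}{e^{\pi i x}-e^{-\pi i x}}\,dx\] be Riemann's auxiliary function, where the path of integration is the straight line of direction $e^{5\pi i/4}$ (from the upper right to the lower left) that crosses the real axis at a point between $0$ and $1$, say at $\tfrac12$, and $x^{-s}$ is the principal power. Let \[\chi(s)=\pi^{s-1/2}\,\frac{\Gamma\bigl(\frac{1-s}{2}\bigr)}{\Gamma\bigl(\frac{s}{2}\bigr)},\] and, for $\sigma<1$ and $t>0$, let $\eta=\sqrt{(s-1)/(2\pi i)}$ be the principal square root (that is, the root with $\operatorname{Re}\eta+\operatorname{Im}\eta>0$), and let $\eta^{s-1}$ be the principal power. Theorem. There exist constants $A$ and $t_0>1$ such that for every $s$ in the closed set \[\Omega=\{s\in\mathbf{C}\colon t\ge t_0,\quad 1-\sigma\ge t^{3/7}\}\] we have \[R(s)=-\chi(s)\,\eta^{s-1}e^{-\pi i\eta^2}\,\frac{\sqrt2\,e^{3\pi i/8}\sin\pi\eta}{2\cos2\pi\eta}\,(1+U),\qquad |U|\le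 A\,t^{-1/21}.\] -/

import Mathlib

noncomputable section

namespace RiemannAux

/-- The integrand `x^{-s} e^{π i x²} / (e^{π i x} - e^{-π i x})`, where `x^{-s}` is the principal
power (the path of integration below does not meet the negative real axis). -/
def integrand (s x : ℂ) : ℂ :=
  x ^ (-s) * Complex.exp (Real.pi * Complex.I * x ^ 2) /
    (Complex.exp (Real.pi * Complex.I * x) - Complex.exp (-(Real.pi * Complex.I * x)))

/-- The direction `e^{5π i/4}` (from the upper right to the lower left) of the path `0 ↙ 1`. -/
def dir : ℂ := Complex.exp (5 * Real.pi * Complex.I / 4)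

/-- The path `0 ↙ 1`: the straight line of direction `e^{5π i/4}` that crosses the real axis
at the point `1/2`, strictly between `0` and `1`. -/
def path (u : ℝ) : ℂ := 1 / 2 + (u : ℂ) * dir

/-- Riemann's auxiliary function, `R(s) = ∫_{0 ↙ 1} x^{-s} e^{π i x²} / (e^{π i x} - e^{-π i x}) dx`.
The integrand has Gaussian decay along the line, so that the integral converges absolutely. -/
def R (s : ℂ) : ℂ := ∫ u : ℝ, integrand s (path u) * dir

/-- The factor of the functional equation `ζ(s) = χ(s) ζ(1 - s)`:
`χ(s) = π^{s - 1/2} Γ((1 - s)/2) / Γ(s/2)`. -/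
def chi (s : ℂ) : ℂ :=
  (Real.pi : ℂ) ^ (s - 1 / 2) * Complex.Gamma ((1 - s) / 2) / Complex.Gamma (s / 2)

/-- The square root `η = ((s - 1)/(2π i))^{1/2}`, principal branch. When `Re s < 1` and `Im s > 0`
the radicand lies in the open first quadrant, so this is the root with `Re η + Im η > 0`. -/
def eta (s : ℂ) : ℂ := ((s - 1) / (2 * Real.pi * Complex.I)) ^ (1 / 2 : ℂ)

/-- The closed set of all `s = σ + i t` with `t ≥ t₀` and `1 - σ ≥ t^{3/7}`. -/
def Omega (t₀ : ℝ) : Set ℂ := {s : ℂ | t₀ ≤ s.im ∧ s.im ^ (3 / 7 : ℝ) ≤ 1 - s.re}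

/-- The main term
`-χ(s) η^{s-1} e^{-π i η²} (√2 e^{3π i/8} sin π η) / (2 cos 2π η)`. -/
def mainTerm (s : ℂ) : ℂ :=
  -chi s * eta s ^ (s - 1) * Complex.exp (-(Real.pi * Complex.I * eta s ^ 2)) *
    ((Real.sqrt 2 : ℂ) * Complex.exp (3 * Real.pi * Complex.I / 8) *
        Complex.sin (Real.pi * eta s) /
      (2 * Complex.cos (2 * Real.pi * eta s)))

end RiemannAux

end

namespace RiemannAux

open Complex Set MeasureTheory Filter Topology

/-! Write s = 1 + 2πiη², so that η lies in the first quadrant with 0 < Im η ≤ Re η. By Cauchy's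
theorem and the reflection z ↦ -z, which multiplies z^{-s} by e^{πis}, R(s) equals -(1 - e^{πis}) J,
where J is the integral of the same integrand along a ray in that quadrant (`R_eq_ray`).

On the ray, 1/(e^{πiz} - e^{-πiz}) expands into -∑ e^{πicz} over odd c > 0. The integral of z^{-s}
e^{πi(z² + cz)} has its saddle near η. With E = `exp (expo η 0 η)`, steepest descent gives the value
(E/η) e^{πicη} e^{πi/4} e^{-πic²/8}/√2, with relative error O(|η|^{-2/5}) uniformly for c ≤
|η|^{1/5} (`norm_integral_kernel_sub_le`). Odd squares are 1, 9, 9, 1 modulo 16, periodically, so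
the phases have period four and the sum over c is geometric (`sum_exp_odd_sq_mul_pow`); it produces
sin πη / cos 2πη. The remaining frequencies are estimated in absolute value
(`norm_tail_integrand_le`).

The factor χ(s) also contains 1 - e^{πis}, together with Γ(1-s). The same saddle point lemma at √2 η
is a Stirling formula (`norm_Gamma_sub_le`), by which χ carries E². Since η^{s-1} e^{-πiη²} = 1/E,
the main term carries E, as J does.

Put Q = e^{-π Im η} and |η| = M^35. Summing the errors and dividing by the trigonometric factor, of
size at least Q(1 - Q²)/3, costs (1 - Q²)^{-2}. The condition 1 - σ ≥ t^{3/7} forces Im η ≥ 1/(13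
M^5) (`one_le_mul_im`), so the error is O(M^{-14} M^{10}) = O(M^{-4}). As t ≤ 7 M^70, this is more
than enough for t^{-1/21}. -/

/-! ### Moving contours from a ray to a segment and a half-line -/

theorem integrableOn_Ioc_zero_of_bounded {f : ℝ → ℂ} {M δ C : ℝ} (hf : ContinuousOn f (Ioc 0 M))
    (hδ : 0 < δ) (h0 : ∀ r, 0 < r → r < δ → r ≤ M → ‖f r‖ ≤ C) : IntegrableOn f (Ioc 0 M) := by
  obtain ⟨C', hC'⟩ := (isCompact_Icc (a := δ) (b := M)).exists_bound_of_continuousOn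
    (hf.mono fun r hr => ⟨hδ.trans_le hr.1, hr.2⟩)
  refine Integrable.mono' (g := fun _ => max C C') (by simp)
    (hf.aestronglyMeasurable measurableSet_Ioc) ?_
  refine (ae_restrict_iff' measurableSet_Ioc).2 (ae_of_all _ fun r hr => ?_)
  rcases lt_or_ge r δ with h | h
  · exact (h0 r hr.1 h hr.2).trans (le_max_left _ _)
  · exact (hC' r ⟨h, hr.2⟩).trans (le_max_right _ _)

theorem integrableOn_Ioi_zero_of_bounded_of_decay {f : ℝ → ℂ} {N δ C : ℝ}
    (hf : ContinuousOn f (Ioi 0)) (hδ : 0 < δ) (h0 : ∀ r, 0 < r → r < δ → ‖f r‖ ≤ C)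
    (hN : ∀ r, N ≤ r → ‖f r‖ ≤ Real.exp (-r)) : IntegrableOn f (Ioi 0) := by
  set M := max N 1
  have hM : 0 < M := lt_of_lt_of_le one_pos (le_max_right _ _)
  rw [← Ioc_union_Ioi_eq_Ioi hM.le]
  refine IntegrableOn.union (integrableOn_Ioc_zero_of_bounded (C := C)
    (hf.mono fun r hr => hr.1) hδ fun r h1 h2 _ => h0 r h1 h2) ?_
  have hE : IntegrableOn (fun r : ℝ => Real.exp (-r)) (Ioi M) := by
    simpa using integrableOn_exp_neg_Ioi M
  refine Integrable.mono' hE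
    ((hf.mono fun r hr => hM.trans hr).aestronglyMeasurable measurableSet_Ioi) ?_
  exact (ae_restrict_iff' measurableSet_Ioi).2 (ae_of_all _ fun r hr =>
    hN r ((le_max_left _ _).trans (mem_Ioi.1 hr).le))

theorem integral_line_eq_sub {F Φ : ℂ → ℂ} {U : Set ℂ} (hΦ : ∀ z ∈ U, HasDerivAt Φ (F z) z)
    (hF : ContinuousOn F U) {z₁ e : ℂ} {a b : ℝ} (hab : a ≤ b)
    (h : ∀ r : ℝ, a ≤ r → r ≤ b → z₁ + r * e ∈ U) :
    ∫ r in a..b, F (z₁ + r * e) * e = Φ (z₁ + b * e) - Φ (z₁ + a * e) := by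
  have hline : ∀ r : ℝ, HasDerivAt (fun r : ℝ => z₁ + r * e) e r := fun r => by
    simpa using ((ofRealCLM.hasDerivAt (x := r)).mul_const e).const_add z₁
  refine intervalIntegral.integral_eq_sub_of_hasDerivAt (f := fun r : ℝ => Φ (z₁ + r * e))
    (fun r hr => ?_) ?_
  · rw [uIcc_of_le hab] at hr
    exact (hΦ _ (h r hr.1 hr.2)).comp r (hline r)
  · refine ContinuousOn.intervalIntegrable ?_
    rw [uIcc_of_le hab]
    refine ContinuousOn.mul (hF.comp (by fun_prop) fun r hr => h r hr.1 hr.2) continuousOn_const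

/-- For `F` holomorphic on a convex open set, bounded near `0` and decaying between two directions
`e` and `d`, the integral along the ray of direction `e` equals the integral along the segment
from `0` to `z₀` followed by the half-line of direction `d`. -/
theorem integral_ray_eq_segment_add_halfLine {F : ℂ → ℂ} {U : Set ℂ} (hU : Convex ℝ U)
    (hUo : IsOpen U) (hF : DifferentiableOn ℂ F U) {e z₀ d : ℂ}
    (he : ∀ r : ℝ, 0 < r → r * e ∈ U) (hz : ∀ r : ℝ, 0 < r → r ≤ 1 → r * z₀ ∈ U)
    (hd : ∀ r : ℝ, 0 ≤ r → z₀ + r * d ∈ U) {C δ N : ℝ} (hδ : 0 < δ)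
    (h0 : ∀ z ∈ U, ‖z‖ < δ → ‖F z‖ ≤ C)
    (hinf : ∀ r : ℝ, N ≤ r → ∀ x : ℝ, 0 ≤ x → x ≤ 1 →
      ‖F (r * ((1 - x) * e + x * d) + x * z₀)‖ ≤ Real.exp (-r)) :
    IntegrableOn (fun r : ℝ => F (r * e)) (Ioi 0) ∧
    IntegrableOn (fun r : ℝ => F (z₀ + r * d)) (Ioi 0) ∧
    IntegrableOn (fun r : ℝ => F (r * z₀)) (Ioc 0 1) ∧
    ∫ r in Ioi (0 : ℝ), F (r * e) * e =
      (∫ r in Ioc (0 : ℝ) 1, F (r * z₀) * z₀) + ∫ r in Ioi (0 : ℝ), F (z₀ + r * d) * d := by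
  have hFc := hF.continuousOn
  have hce : ContinuousOn (fun r : ℝ => F (r * e)) (Ioi 0) :=
    hFc.comp (by fun_prop) fun r hr => he r hr
  have hcd : ContinuousOn (fun r : ℝ => F (z₀ + r * d)) (Ici 0) :=
    hFc.comp (by fun_prop) fun r hr => hd r hr
  have hcz : ContinuousOn (fun r : ℝ => F (r * z₀)) (Ioc 0 1) :=
    hFc.comp (by fun_prop) fun r hr => hz r hr.1 hr.2
  have hsmall : ∀ e : ℂ, ∃ δ' > 0, ∀ r : ℝ, 0 < r → r < δ' → ‖(r : ℂ) * e‖ < δ := by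
    intro e
    refine ⟨δ / (‖e‖ + 1), by positivity, fun r h1 h2 => ?_⟩
    rw [norm_mul, norm_real, Real.norm_of_nonneg h1.le]
    rw [lt_div_iff₀ (by positivity)] at h2
    nlinarith [norm_nonneg e]
  have hie : IntegrableOn (fun r : ℝ => F (r * e)) (Ioi 0) := by
    obtain ⟨δ', h1, h2⟩ := hsmall e
    refine integrableOn_Ioi_zero_of_bounded_of_decay (N := N) (C := C) hce h1
      (fun r h3 h4 => h0 _ (he r h3) (h2 r h3 h4)) fun r hr => ?_
    simpa using hinf r hr 0 le_rfl zero_le_one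
  have hid : IntegrableOn (fun r : ℝ => F (z₀ + r * d)) (Ioi 0) := by
    obtain ⟨C', hC'⟩ := (isCompact_Icc (a := (0:ℝ)) (b := 1)).exists_bound_of_continuousOn
      (hcd.mono Icc_subset_Ici_self)
    refine integrableOn_Ioi_zero_of_bounded_of_decay (N := N) (C := C') (hcd.mono Ioi_subset_Ici_self)
      one_pos (fun r h3 h4 => hC' r ⟨h3.le, h4.le⟩) fun r hr => ?_
    simpa [add_comm] using hinf r hr 1 zero_le_one le_rfl
  have hiz : IntegrableOn (fun r : ℝ => F (r * z₀)) (Ioc 0 1) := by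
    obtain ⟨δ', h1, h2⟩ := hsmall z₀
    exact integrableOn_Ioc_zero_of_bounded (C := C) hcz h1
      fun r h3 h4 h5 => h0 _ (hz r h3 h5) (h2 r h3 h4)
  refine ⟨hie, hid, hiz, ?_⟩
  -- Convexity supplies a primitive Φ. The three integrals, cut off at ε n and n + 1, become
  -- differences of values of Φ, and only the gaps between the two paths near 0 and near infinity
  -- remain.
  obtain ⟨Φ, hΦ'⟩ := hU.exists_forall_hasDerivWithinAt hF
  have hΦ : ∀ z ∈ U, HasDerivAt Φ (F z) z := fun z hz => (hΦ' z hz).hasDerivAt (hUo.mem_nhds hz)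
  have hmv : ∀ z₁ ∈ U, ∀ z₂ ∈ U, ∀ B : ℝ,
      (∀ x : ℝ, 0 ≤ x → x ≤ 1 → ‖F ((1 - x) * z₁ + x * z₂)‖ ≤ B) →
      ‖Φ z₂ - Φ z₁‖ ≤ B * ‖z₂ - z₁‖ := by
    intro z₁ h1 z₂ h2 B hB
    refine Convex.norm_image_sub_le_of_norm_hasDerivWithin_le (f := Φ) (f' := F)
      (s := segment ℝ z₁ z₂) (fun z hz => (hΦ z (hU.segment_subset h1 h2 hz)).hasDerivWithinAt) ?_
      (convex_segment _ _) (left_mem_segment ℝ _ _) (right_mem_segment ℝ _ _)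
    rintro z ⟨a, b, ha, hb, hab, rfl⟩
    have : a = 1 - b := by linarith
    subst this
    simpa using hB b hb (by linarith)
  set ε : ℕ → ℝ := fun n => 1 / ((n : ℝ) + 1)
  have hε : ∀ n, 0 < ε n := fun n => by positivity
  have hε1 : ∀ n, ε n ≤ 1 := fun n => by
    rw [div_le_one (by positivity)]; linarith [(Nat.cast_nonneg n : (0:ℝ) ≤ n)]
  have hN1 : ∀ n : ℕ, (1 : ℝ) ≤ (n : ℝ) + 1 := fun n => by linarith [(Nat.cast_nonneg n : (0:ℝ) ≤ n)]
  have hεt : Tendsto ε atTop (𝓝 0) := tendsto_one_div_add_atTop_nhds_zero_nat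
  have hanti : ∀ m n : ℕ, m ≤ n → ε n ≤ ε m := fun m n h => by
    have : (m : ℝ) ≤ n := by exact_mod_cast h
    exact one_div_le_one_div_of_le (by positivity) (by linarith)
  have hevε : ∀ r : ℝ, 0 < r → ∃ n, ∀ m, n ≤ m → ε m < r := fun r hr => by
    obtain ⟨n, hn⟩ := ((tendsto_order.1 hεt).2 r hr).exists_forall_of_atTop
    exact ⟨n, hn⟩
  have hUn1 : (⋃ n : ℕ, Ioc (ε n) ((n : ℝ) + 1)) = Ioi 0 := by
    ext r
    simp only [mem_iUnion, mem_Ioc, mem_Ioi]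
    refine ⟨fun ⟨n, h1, _⟩ => (hε n).trans h1, fun hr => ?_⟩
    obtain ⟨n, hn⟩ := hevε r hr
    obtain ⟨m, hm⟩ := exists_nat_gt r
    refine ⟨max n m, hn _ (le_max_left _ _), ?_⟩
    have : (m : ℝ) ≤ ((max n m : ℕ) : ℝ) := by exact_mod_cast le_max_right n m
    linarith
  have hUn2 : (⋃ n : ℕ, Ioc (ε n) (1:ℝ)) = Ioc 0 1 := by
    ext r
    simp only [mem_iUnion, mem_Ioc]
    refine ⟨fun ⟨n, h1, h2⟩ => ⟨(hε n).trans h1, h2⟩, fun hr => ?_⟩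
    obtain ⟨n, hn⟩ := hevε r hr.1
    exact ⟨n, hn _ le_rfl, hr.2⟩
  have hUn3 : (⋃ n : ℕ, Ioc (0:ℝ) ((n : ℝ) + 1)) = Ioi 0 := by
    ext r
    simp only [mem_iUnion, mem_Ioc, mem_Ioi]
    refine ⟨fun ⟨n, h1, _⟩ => h1, fun hr => ?_⟩
    obtain ⟨m, hm⟩ := exists_nat_gt r
    exact ⟨m, hr, by linarith⟩
  have hmonoN : ∀ m n : ℕ, m ≤ n → (m : ℝ) + 1 ≤ n + 1 := fun m n h => by
    have : (m : ℝ) ≤ n := by exact_mod_cast h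
    linarith
  have t1 : Tendsto (fun n : ℕ => ∫ r in Ioc (ε n) ((n:ℝ) + 1), F (r * e) * e) atTop
      (𝓝 (∫ r in Ioi (0 : ℝ), F (r * e) * e)) := by
    rw [← hUn1]
    refine tendsto_setIntegral_of_monotone (fun n => measurableSet_Ioc)
      (fun m n h => Ioc_subset_Ioc (hanti m n h) (hmonoN m n h)) ?_
    rw [hUn1]; exact hie.mul_const e
  have t2 : Tendsto (fun n : ℕ => ∫ r in Ioc (ε n) 1, F (r * z₀) * z₀) atTop
      (𝓝 (∫ r in Ioc (0 : ℝ) 1, F (r * z₀) * z₀)) := by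
    rw [← hUn2]
    refine tendsto_setIntegral_of_monotone (fun n => measurableSet_Ioc)
      (fun m n h => Ioc_subset_Ioc (hanti m n h) le_rfl) ?_
    rw [hUn2]; exact hiz.mul_const z₀
  have t3 : Tendsto (fun n : ℕ => ∫ r in Ioc (0:ℝ) ((n:ℝ) + 1), F (z₀ + r * d) * d) atTop
      (𝓝 (∫ r in Ioi (0 : ℝ), F (z₀ + r * d) * d)) := by
    rw [← hUn3]
    refine tendsto_setIntegral_of_monotone (fun n => measurableSet_Ioc)
      (fun m n h => Ioc_subset_Ioc le_rfl (hmonoN m n h)) ?_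
    rw [hUn3]; exact hid.mul_const d
  have t4 := t1.sub (t2.add t3)
  rw [← sub_eq_zero]
  refine tendsto_nhds_unique t4 ?_
  have key : ∀ n : ℕ, (∫ r in Ioc (ε n) ((n:ℝ) + 1), F (r * e) * e) -
      ((∫ r in Ioc (ε n) 1, F (r * z₀) * z₀) + ∫ r in Ioc (0:ℝ) ((n:ℝ) + 1), F (z₀ + r * d) * d)
      = (Φ (ε n * z₀) - Φ (ε n * e)) -
        (Φ (z₀ + ((n:ℝ) + 1 : ℝ) * d) - Φ (((n:ℝ) + 1 : ℝ) * e)) := by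
    intro n
    have a1 := integral_line_eq_sub hΦ hFc (z₁ := 0) (e := e) ((hε1 n).trans (hN1 n))
      fun r h1 _ => by simpa using he r ((hε n).trans_le h1)
    have a2 := integral_line_eq_sub hΦ hFc (z₁ := 0) (e := z₀) (hε1 n)
      fun r h1 h2 => by simpa using hz r ((hε n).trans_le h1) h2
    have a3 := integral_line_eq_sub hΦ hFc (z₁ := z₀) (e := d) (zero_le_one.trans (hN1 n))
      fun r h1 _ => hd r h1
    rw [intervalIntegral.integral_of_le (by linarith [hε1 n, hN1 n])] at a1 a2 a3
    simp only [zero_add] at a1 a2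
    rw [a1, a2, a3]
    simp
    ring
  simp_rw [key]
  rw [← sub_zero (0 : ℂ)]
  refine Tendsto.sub ?_ ?_
  -- Near 0 the gap is at most the bound C for F times a length of order ε n.
  · refine squeeze_zero_norm' (a := fun n => C * (ε n * ‖z₀ - e‖)) ?_ ?_
    · obtain ⟨δ₁, h1, h2⟩ := hsmall e
      obtain ⟨δ₂, h3, h4⟩ := hsmall z₀
      obtain ⟨n, hn⟩ := hevε (min δ₁ δ₂) (lt_min h1 h3)
      filter_upwards [eventually_ge_atTop n] with m hm
      have b1 := h2 _ (hε m) ((hn m hm).trans_le (min_le_left _ _))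
      have b2 := h4 _ (hε m) ((hn m hm).trans_le (min_le_right _ _))
      have := hmv _ (he _ (hε m)) _ (hz _ (hε m) (hε1 m)) C fun x hx0 hx1 => ?_
      · rwa [← mul_sub, norm_mul, norm_real, Real.norm_of_nonneg (hε m).le] at this
      · refine h0 _ ?_ ?_
        · have := hU (he _ (hε m)) (hz _ (hε m) (hε1 m)) (sub_nonneg.2 hx1) hx0 (by ring)
          simpa using this
        · have : _ ∈ Metric.ball (0:ℂ) δ := (convex_ball (0:ℂ) δ) (mem_ball_zero_iff.2 b1) (mem_ball_zero_iff.2 b2)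
            (sub_nonneg.2 hx1) hx0 (by ring)
          simpa using this
    · have := (hεt.mul_const ‖z₀ - e‖).const_mul C
      simpa using this
  -- Near infinity the gap has length O(n), while F is at most e^{-(n+1)} on the segment joining the
  -- two paths.
  · refine squeeze_zero_norm' (a := fun n : ℕ => Real.exp (-((n : ℝ) + 1)) *
      (((n:ℝ) + 1) * (‖z₀‖ + ‖d - e‖))) ?_ ?_
    · obtain ⟨n, hn⟩ := exists_nat_gt N
      filter_upwards [eventually_ge_atTop n] with m hm
      have hm' : (n : ℝ) ≤ m := by exact_mod_cast hm
      have hmp : (0:ℝ) < (m:ℝ) + 1 := by positivity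
      refine (hmv _ (he _ hmp) _ (hd _ hmp.le) (Real.exp (-((m : ℝ) + 1)))
        fun x hx0 hx1 => ?_).trans ?_
      · have := hinf ((m:ℝ) + 1) (by linarith) x hx0 hx1
        convert this using 3
        ring
      · refine mul_le_mul_of_nonneg_left ?_ (Real.exp_pos _).le
        have : z₀ + (((m:ℝ) + 1 : ℝ) : ℂ) * d - (((m:ℝ) + 1 : ℝ) : ℂ) * e =
          z₀ + (((m:ℝ) + 1 : ℝ) : ℂ) * (d - e) := by ring
        rw [this]
        refine (norm_add_le _ _).trans ?_
        rw [norm_mul, norm_real, Real.norm_of_nonneg hmp.le]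
        nlinarith [norm_nonneg z₀, hN1 m]
    · have h1 : Tendsto (fun x : ℝ => x * Real.exp (-x)) atTop (𝓝 0) := by
        simpa using Real.tendsto_pow_mul_exp_neg_atTop_nhds_zero 1
      have h2 : Tendsto (fun n : ℕ => (n:ℝ) + 1) atTop atTop :=
        tendsto_atTop_add_const_right _ _ tendsto_natCast_atTop_atTop
      have := (h1.comp h2).mul_const (‖z₀‖ + ‖d - e‖)
      simp only [zero_mul] at this
      refine this.congr fun n => ?_
      simp only [Function.comp]
      ring

/-! ### Growth of the kernel -/

/-- The factor `z^{-s} e^{π i z²}` common to all the integrands. -/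
noncomputable def kernel (s z : ℂ) : ℂ := z ^ (-s) * exp (Real.pi * I * z ^ 2)

theorem norm_exp_pi_I_mul (z : ℂ) : ‖exp (Real.pi * I * z)‖ = Real.exp (-(Real.pi * z.im)) := by
  rw [norm_exp]; congr 1; simp

theorem norm_kernel_le {s : ℂ} (z : ℂ) :
    ‖kernel s z‖ ≤ ‖z‖ ^ (-s.re) * Real.exp (Real.pi * |s.im|) *
      Real.exp (-(Real.pi * (z ^ 2).im)) := by
  rw [kernel, norm_mul, norm_exp_pi_I_mul]
  gcongr
  refine (norm_cpow_le _ _).trans ?_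
  rw [div_eq_mul_inv, ← Real.exp_neg, neg_re, neg_im]
  gcongr
  have h1 : |arg z * s.im| ≤ Real.pi * |s.im| := by
    rw [abs_mul]; gcongr; exact abs_arg_le_pi z
  linarith [le_abs_self (arg z * s.im)]

theorem differentiableOn_kernel {s : ℂ} {U : Set ℂ} (hU : U ⊆ slitPlane) :
    DifferentiableOn ℂ (kernel s) U := by
  intro z hz
  unfold kernel
  refine ((differentiableAt_id.cpow_const (hU hz)).mul ?_).differentiableWithinAt
  fun_prop

/-- The Gaussian factor e^{-πκr²} beats everything else, which is exponential of linear growth in r.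
The threshold N does not depend on z and g, as the contour lemma needs uniformity between the two
directions. -/
theorem exists_norm_kernel_mul_le_exp_neg {s : ℂ} (hs : s.re ≤ 0) {κ C : ℝ} (hκ : 0 < κ)
    (hC : 0 ≤ C) : ∃ N : ℝ, ∀ r : ℝ, N ≤ r → ∀ z g : ℂ, ‖z‖ ≤ C * (r + 1) →
      κ * r ^ 2 - C * (r + 1) ≤ (z ^ 2).im → ‖g‖ ≤ Real.exp (C * (r + 1)) →
      ‖kernel s z * g‖ ≤ Real.exp (-r) := by
  set D := -s.re * C + Real.pi * |s.im| + Real.pi * C + C with hD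
  have hD0 : 0 ≤ D := by have := Real.pi_pos; have := neg_nonneg.2 hs; positivity
  -- For r ≥ 1 the linear terms total at most D(r + 1) ≤ 2Dr; the second bound on r gives πκr² ≥ (2D
  -- + 1)r, which leaves -r.
  refine ⟨max 1 ((2 * D + 1) / (Real.pi * κ)), fun r hr z g hz hz2 hg => ?_⟩
  have h1 : 1 ≤ r := (le_max_left _ _).trans hr
  have h2 : 2 * D + 1 ≤ r * (Real.pi * κ) := by
    rw [← div_le_iff₀ (mul_pos Real.pi_pos hκ)]; exact (le_max_right _ _).trans hr
  have h3 : ‖z‖ ^ (-s.re) ≤ Real.exp (-s.re * (C * (r + 1))) := by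
    rw [mul_comm, Real.exp_mul]
    refine Real.rpow_le_rpow (norm_nonneg _) (hz.trans ?_) (neg_nonneg.2 hs)
    linarith [Real.add_one_le_exp (C * (r + 1))]
  rw [norm_mul]
  calc ‖kernel s z‖ * ‖g‖ ≤ (Real.exp (-s.re * (C * (r + 1))) * Real.exp (Real.pi * |s.im|) *
      Real.exp (-(Real.pi * (κ * r ^ 2 - C * (r + 1))))) * Real.exp (C * (r + 1)) := by
        have := Real.pi_pos
        gcongr
        refine (norm_kernel_le z).trans ?_
        gcongr
    _ ≤ Real.exp (-r) := by
        rw [← Real.exp_add, ← Real.exp_add, ← Real.exp_add]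
        refine Real.exp_le_exp.2 ?_
        have h4 : 0 ≤ Real.pi * |s.im| := by have := Real.pi_pos; positivity
        have h5 : D * (r + 1) ≤ 2 * D * r := by nlinarith
        have h6 : (2 * D + 1) * r ≤ Real.pi * κ * r ^ 2 := by nlinarith
        have h7 : D * (r + 1) = -s.re * (C * (r + 1)) + Real.pi * |s.im| * (r + 1) +
          Real.pi * C * (r + 1) + C * (r + 1) := by rw [hD]; ring
        nlinarith

/-- The points between two half-lines are rω + x z₀ with ω between the directions. On squaring, the
displacement x z₀ contributes only terms linear in r, so Im z² keeps its quadratic growth. -/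
theorem exists_bounds_of_quadrant {e d z₀ : ℂ} {κ : ℝ}
    (hκ : ∀ x : ℝ, 0 ≤ x → x ≤ 1 → κ ≤ (((1 - x) * e + x * d) ^ 2).im) :
    ∃ C : ℝ, 0 ≤ C ∧ ∀ r : ℝ, 0 ≤ r → ∀ x : ℝ, 0 ≤ x → x ≤ 1 →
      ‖r * ((1 - x) * e + x * d) + x * z₀‖ ≤ C * (r + 1) ∧
      κ * r ^ 2 - C * (r + 1) ≤ ((r * ((1 - x) * e + x * d) + x * z₀ : ℂ) ^ 2).im := by
  set A := ‖e‖ + ‖d‖ with hA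
  set B := ‖z₀‖
  have hA0 : 0 ≤ A := by positivity
  have hB0 : 0 ≤ B := norm_nonneg _
  refine ⟨A + B + 2 * A * B + B ^ 2, by positivity, fun r hr x hx0 hx1 => ?_⟩
  have h1 : ‖(1 - x) * e + x * d‖ ≤ A := by
    refine (norm_add_le _ _).trans ?_
    have : ‖(1 - x : ℂ)‖ = 1 - x := by
      rw [← ofReal_one, ← ofReal_sub, norm_real, Real.norm_of_nonneg (by linarith)]
    rw [norm_mul, norm_mul, this, norm_real, Real.norm_of_nonneg hx0]
    nlinarith [norm_nonneg e, norm_nonneg d]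
  set ω := (1 - x) * e + x * d with hω
  have h2 : ‖x * z₀‖ ≤ B := by
    rw [norm_mul, norm_real, Real.norm_of_nonneg hx0]
    nlinarith [norm_nonneg z₀]
  have h3 : ‖r * ω‖ ≤ r * A := by
    rw [norm_mul, norm_real, Real.norm_of_nonneg hr]; gcongr
  constructor
  · refine (norm_add_le _ _).trans ?_
    have : 0 ≤ A * B := by positivity
    nlinarith [mul_nonneg hr hA0, mul_nonneg hr hB0, mul_nonneg hr this, mul_nonneg hr (sq_nonneg B),
      sq_nonneg B]
  · have h4 : (r * ω + x * z₀) ^ 2 = (r ^ 2 : ℝ) * ω ^ 2 + (2 * (r * ω) * (x * z₀) + (x * z₀) ^ 2) := by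
      push_cast; ring
    have h5 : ‖2 * (r * ω) * (x * z₀) + (x * z₀) ^ 2‖ ≤ 2 * (r * A) * B + B ^ 2 := by
      refine (norm_add_le _ _).trans ?_
      rw [norm_mul, norm_mul, norm_pow]
      have : ‖(2:ℂ)‖ = 2 := by simp
      rw [this]
      gcongr
    have h6 := (abs_le.1 ((abs_im_le_norm _).trans h5)).1
    rw [h4, add_im, im_ofReal_mul]
    have h7 := mul_le_mul_of_nonneg_left (hκ x hx0 hx1) (sq_nonneg r)
    nlinarith [mul_nonneg hr hA0, mul_nonneg hr hB0, mul_nonneg hA0 hB0, mul_nonneg hr (sq_nonneg B)]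

theorem exists_le_im_sq_of_pos {e d : ℂ} (he1 : 0 < e.re) (he2 : 0 < e.im) (hd1 : 0 < d.re)
    (hd2 : 0 < d.im) :
    ∃ κ : ℝ, 0 < κ ∧ ∀ x : ℝ, 0 ≤ x → x ≤ 1 → κ ≤ ((1 - x) * e + x * d : ℂ).im ∧
      κ ≤ (((1 - x) * e + x * d) ^ 2).im := by
  set m := min (min e.re e.im) (min d.re d.im)
  have hm : 0 < m := lt_min (lt_min he1 he2) (lt_min hd1 hd2)
  have m1 : m ≤ e.re := (min_le_left _ _).trans (min_le_left _ _)
  have m2 : m ≤ e.im := (min_le_left _ _).trans (min_le_right _ _)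
  have m3 : m ≤ d.re := (min_le_right _ _).trans (min_le_left _ _)
  have m4 : m ≤ d.im := (min_le_right _ _).trans (min_le_right _ _)
  refine ⟨min m (2 * (m * m)), lt_min hm (by positivity), fun x hx0 hx1 => ?_⟩
  have h1 : m ≤ ((1 - x) * e + x * d : ℂ).re := by
    simp; nlinarith
  have h2 : m ≤ ((1 - x) * e + x * d : ℂ).im := by
    simp; nlinarith
  refine ⟨(min_le_left _ _).trans h2, (min_le_right _ _).trans ?_⟩
  set ω := ((1 - x) * e + x * d : ℂ)
  have : (ω ^ 2).im = 2 * (ω.re * ω.im) := by rw [sq, mul_im]; ring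
  rw [this]
  have := mul_le_mul h1 h2 hm.le (hm.le.trans h1)
  linarith

/-- The contour lemma for integrands `kernel s z * G z`. -/
theorem integral_kernel_ray_eq {s : ℂ} (hs : s.re ≤ -1) {G : ℂ → ℂ} {U : Set ℂ}
    (hU : Convex ℝ U) (hUo : IsOpen U) (hUs : U ⊆ slitPlane) (hG : DifferentiableOn ℂ G U)
    {e z₀ d : ℂ}
    (he : ∀ r : ℝ, 0 < r → r * e ∈ U) (hz : ∀ r : ℝ, 0 < r → r ≤ 1 → r * z₀ ∈ U)
    (hd : ∀ r : ℝ, 0 ≤ r → z₀ + r * d ∈ U) {κ : ℝ} (hκ0 : 0 < κ)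
    (hκ : ∀ x : ℝ, 0 ≤ x → x ≤ 1 → κ ≤ (((1 - x) * e + x * d) ^ 2).im)
    {C δ C' N : ℝ} (hδ : 0 < δ) (hG0 : ∀ z ∈ U, ‖z‖ < δ → ‖G z‖ * ‖z‖ ≤ C)
    (hGinf : ∀ r : ℝ, N ≤ r → ∀ x : ℝ, 0 ≤ x → x ≤ 1 →
      ‖G (r * ((1 - x) * e + x * d) + x * z₀)‖ ≤ Real.exp (C' * (r + 1))) :
    IntegrableOn (fun r : ℝ => kernel s (r * e) * G (r * e)) (Ioi 0) ∧
    IntegrableOn (fun r : ℝ => kernel s (z₀ + r * d) * G (z₀ + r * d)) (Ioi 0) ∧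
    IntegrableOn (fun r : ℝ => kernel s (r * z₀) * G (r * z₀)) (Ioc 0 1) ∧
    ∫ r in Ioi (0 : ℝ), kernel s (r * e) * G (r * e) * e =
      (∫ r in Ioc (0 : ℝ) 1, kernel s (r * z₀) * G (r * z₀) * z₀) +
        ∫ r in Ioi (0 : ℝ), kernel s (z₀ + r * d) * G (z₀ + r * d) * d := by
  obtain ⟨C₁, hC₁, hb⟩ := exists_bounds_of_quadrant (z₀ := z₀) hκ
  obtain ⟨N', hN'⟩ := exists_norm_kernel_mul_le_exp_neg (s := s) (by linarith) hκ0
    (le_max_of_le_left hC₁ : 0 ≤ max C₁ C')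
  refine integral_ray_eq_segment_add_halfLine (F := fun z => kernel s z * G z)
    (C := Real.exp (Real.pi * |s.im|) * Real.exp Real.pi * C) (δ := min δ 1)
    (N := max 0 (max N N')) hU hUo ((differentiableOn_kernel hUs).mul hG) he hz hd
    (lt_min hδ one_pos) (fun z hzU hzn => ?_) fun r hr x hx0 hx1 => ?_
  · have h1 := hG0 z hzU (hzn.trans_le (min_le_left _ _))
    have h2 : ‖z‖ ≤ 1 := (hzn.trans_le (min_le_right _ _)).le
    -- This is where Re s ≤ -1 enters: the zero of z^{-s} at the origin absorbs a simple pole of G.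
    have h3 : ‖z‖ ^ (-s.re) ≤ ‖z‖ := by
      have := Real.rpow_le_rpow_of_exponent_ge' (norm_nonneg z) h2 zero_le_one
        (by linarith : (1:ℝ) ≤ -s.re)
      simpa using this
    have h4 : -(Real.pi * (z ^ 2).im) ≤ Real.pi := by
      have : |(z ^ 2).im| ≤ 1 := (abs_im_le_norm _).trans (by
        rw [norm_pow]; exact pow_le_one₀ (norm_nonneg _) h2)
      nlinarith [(abs_le.1 this).1, Real.pi_pos]
    rw [norm_mul]
    calc ‖kernel s z‖ * ‖G z‖ ≤ (‖z‖ * Real.exp (Real.pi * |s.im|) * Real.exp Real.pi) * ‖G z‖ := by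
          gcongr
          refine (norm_kernel_le z).trans ?_
          gcongr
      _ = Real.exp (Real.pi * |s.im|) * Real.exp Real.pi * (‖G z‖ * ‖z‖) := by ring
      _ ≤ _ := by gcongr
  · have hr0 : 0 ≤ r := (le_max_left _ _).trans hr
    obtain ⟨b1, b2⟩ := hb r hr0 x hx0 hx1
    refine hN' r ((le_max_right _ _).trans ((le_max_right _ _).trans hr)) _ _ (b1.trans ?_)
      (le_trans ?_ b2) ((hGinf r ((le_max_left _ _).trans ((le_max_right _ _).trans hr)) x hx0 hx1).trans ?_)
    · gcongr; exact le_max_left _ _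
    · gcongr; exact le_max_left _ _
    · gcongr; exact le_max_right _ _

/-! ### The denominator, and R(s) as an integral along a ray -/

/-- The denominator `e^{π i z} - e^{-π i z}`. -/
noncomputable def den (z : ℂ) : ℂ := exp (Real.pi * I * z) - exp (-(Real.pi * I * z))

theorem integrand_eq (s z : ℂ) : integrand s z = kernel s z * (den z)⁻¹ := by
  rw [integrand, kernel, den, div_eq_mul_inv]

theorem den_neg (z : ℂ) : den (-z) = -den z := by
  simp [den]

theorem one_le_norm_den {z : ℂ} (hz : 1 ≤ z.im) : 1 ≤ ‖den z‖ := by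
  have h1 : ‖exp (-(Real.pi * I * z))‖ = Real.exp (Real.pi * z.im) := by
    have := norm_exp_pi_I_mul (-z)
    rw [mul_neg] at this
    rw [this]; simp
  have h2 := norm_sub_norm_le (exp (-(Real.pi * I * z))) (exp (Real.pi * I * z))
  rw [h1, norm_exp_pi_I_mul, norm_sub_rev] at h2
  have h3 : Real.exp (-(Real.pi * z.im)) ≤ 1 := Real.exp_le_one_iff.2 (by
    have := Real.pi_pos; nlinarith)
  have h4 := Real.add_one_le_exp (Real.pi * z.im)
  have h5 := Real.pi_gt_three
  change 1 ≤ ‖_ - _‖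
  nlinarith

theorem eq_intCast_of_den_eq_zero {z : ℂ} (h : den z = 0) : ∃ n : ℤ, z = n := by
  have h1 : exp (Real.pi * I * z) = exp (-(Real.pi * I * z)) := sub_eq_zero.1 h
  obtain ⟨n, hn⟩ := exp_eq_exp_iff_exists_int.1 h1
  refine ⟨n, ?_⟩
  have h2 : (2 * Real.pi * I : ℂ) ≠ 0 := two_pi_I_ne_zero
  have : 2 * Real.pi * I * z = 2 * Real.pi * I * n := by linear_combination hn
  exact mul_left_cancel₀ h2 this

/-- The zero of `den` at 0 is simple, since e^{2πiz} - 1 ≈ 2πiz. The radius 1/13 keeps |2πiz| ≤ 1/2,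
so the quadratic remainder takes away at most half of the linear term. -/
theorem norm_inv_den_mul_norm_le {z : ℂ} (hz : ‖z‖ < 1 / 13) :
    ‖(den z)⁻¹‖ * ‖z‖ ≤ Real.exp Real.pi := by
  set u := 2 * Real.pi * I * z with hu
  have hun : ‖u‖ = 2 * Real.pi * ‖z‖ := by
    rw [hu, norm_mul, norm_mul, norm_mul, norm_I, norm_real, Real.norm_of_nonneg Real.pi_pos.le]
    simp
  have hpi := Real.pi_lt_d2
  have hpi' := Real.pi_gt_three
  have hz0 := norm_nonneg z
  have h1 : ‖u‖ ≤ 1 / 2 := by rw [hun]; nlinarith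
  have h2 := norm_exp_sub_one_sub_id_le (x := u) (by linarith)
  have h3 : ‖u‖ - ‖u‖ ^ 2 ≤ ‖exp u - 1‖ := by
    have h := norm_sub_norm_le u (-(exp u - 1 - u))
    rw [norm_neg] at h
    have e : u - -(exp u - 1 - u) = exp u - 1 := by ring
    rw [e] at h
    linarith
  have h4 : Real.pi * ‖z‖ ≤ ‖exp u - 1‖ := by nlinarith [norm_nonneg u]
  have h5 : den z = exp (-(Real.pi * I * z)) * (exp u - 1) := by
    rw [den, mul_sub, ← exp_add, hu, mul_one]; congr 2; ring
  have h6 : Real.exp (-Real.pi) ≤ ‖exp (-(Real.pi * I * z))‖ := by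
    have := norm_exp_pi_I_mul (-z)
    rw [mul_neg] at this
    rw [this]
    refine Real.exp_le_exp.2 ?_
    have := (abs_le.1 ((abs_im_le_norm z).trans hz.le)).1
    simp; nlinarith
  have h7 : ‖z‖ ≤ Real.exp Real.pi * ‖den z‖ := by
    have h8 : 1 = Real.exp Real.pi * Real.exp (-Real.pi) := by rw [← Real.exp_add]; simp
    rw [h5, norm_mul]
    calc ‖z‖ ≤ Real.pi * ‖z‖ := by nlinarith
      _ ≤ ‖exp u - 1‖ := h4
      _ = Real.exp Real.pi * (Real.exp (-Real.pi) * ‖exp u - 1‖) := by rw [← mul_assoc, ← h8, one_mul]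
      _ ≤ _ := by gcongr
  rw [norm_inv]
  rcases eq_or_ne (den z) 0 with h | h
  · simp [h]; positivity
  · rw [inv_mul_le_iff₀ (norm_pos_iff.2 h), mul_comm]; exact h7

theorem differentiableOn_inv_den {U : Set ℂ} (hU : ∀ n : ℤ, (n : ℂ) ∉ U) :
    DifferentiableOn ℂ (fun z => (den z)⁻¹) U := by
  have : Differentiable ℂ den := by unfold den; fun_prop
  refine this.differentiableOn.inv fun z hz h => ?_
  obtain ⟨n, rfl⟩ := eq_intCast_of_den_eq_zero h
  exact hU n hz

/-- The direction `e^{π i / 4}`. -/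
noncomputable def diag : ℂ := exp (Real.pi * I / 4)

theorem diag_re : diag.re = √2 / 2 := by
  rw [diag, exp_re]; simp

theorem diag_im : diag.im = √2 / 2 := by
  rw [diag, exp_im]; simp

theorem diag_sq : diag ^ 2 = I := by
  rw [diag, ← exp_nat_mul]
  convert exp_pi_div_two_mul_I using 2
  push_cast; ring

theorem norm_diag : ‖diag‖ = 1 := by
  rw [diag, norm_exp]; simp

theorem diag_ne_zero : diag ≠ 0 := exp_ne_zero _

theorem dir_eq : dir = -diag := by
  rw [dir, diag, neg_eq_neg_one_mul, ← exp_pi_mul_I, ← exp_add]; congr 1; ring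

theorem integral_upper {s : ℂ} (hs : s.re ≤ -1) {e : ℂ} (he1 : 0 < e.re) (he2 : 0 < e.im) :
    IntegrableOn (fun r : ℝ => kernel s (r * e) * (den (r * e))⁻¹) (Ioi 0) ∧
    IntegrableOn (fun r : ℝ => kernel s (1 / 2 + r * diag) * (den (1 / 2 + r * diag))⁻¹) (Ioi 0) ∧
    ∫ r in Ioi (0 : ℝ), kernel s (r * e) * (den (r * e))⁻¹ * e =
      (∫ r in Ioc (0 : ℝ) 1, kernel s (r * (1 / 2)) * (den (r * (1 / 2)))⁻¹ * (1 / 2)) +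
        ∫ r in Ioi (0 : ℝ), kernel s (1 / 2 + r * diag) * (den (1 / 2 + r * diag))⁻¹ * diag := by
  have hd1 : 0 < diag.re := by rw [diag_re]; positivity
  have hd2 : 0 < diag.im := by rw [diag_im]; positivity
  obtain ⟨κ, hκ0, hκ⟩ := exists_le_im_sq_of_pos he1 he2 hd1 hd2
  set k : ℝ := min 1 (e.im / e.re) / 2
  have hk0 : 0 < k := by positivity
  have hk1 : k < 1 := by
    have := min_le_left 1 (e.im / e.re)
    simp only [k]; linarith
  have hk2 : k * e.re < e.im := by
    have : k < e.im / e.re := by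
      have := min_le_right 1 (e.im / e.re)
      have : 0 < e.im / e.re := by positivity
      simp only [k]; linarith
    rwa [lt_div_iff₀ he1] at this
  -- The line of slope k through 1 leaves the integers n ≥ 1 outside U, and Re z + Im z > 0 excludes
  -- n ≤ 0. As k is below both the slope of e and the slope 1 of `diag`, the ray and the half-line
  -- stay inside.
  set U : Set ℂ := {z | k * (z.re - 1) < z.im} ∩ {z | 0 < z.re + z.im} with hUdef
  have hUo : IsOpen U := (isOpen_lt (by fun_prop) (by fun_prop)).inter
    (isOpen_lt (by fun_prop) (by fun_prop))
  have hU : Convex ℝ U := by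
    rintro x ⟨hx1, hx2⟩ y ⟨hy1, hy2⟩ a b ha hb hab
    simp only [mem_ofPred_eq] at hx1 hx2 hy1 hy2
    have hb' : b = 1 - a := by linarith
    subst hb'
    rcases ha.eq_or_lt with rfl | ha
    · simpa using ⟨hy1, hy2⟩
    constructor <;> simp <;> nlinarith
  have hUs : U ⊆ slitPlane := by
    rintro z ⟨-, hz⟩
    simp only [mem_ofPred_eq] at hz
    rw [mem_slitPlane_iff]
    by_contra! h
    linarith [h.1, h.2]
  have hn : ∀ n : ℤ, (n : ℂ) ∉ U := by
    rintro n ⟨h1, h2⟩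
    simp at h1 h2
    have : (1 : ℤ) ≤ n := h2
    have : (1 : ℝ) ≤ n := by exact_mod_cast this
    nlinarith
  have main := integral_kernel_ray_eq (s := s) hs hU hUo hUs (differentiableOn_inv_den hn)
    (e := e) (z₀ := 1 / 2) (d := diag) (κ := κ) (C := Real.exp Real.pi) (δ := 1 / 13) (C' := 0)
    (N := 1 / κ) ?_ ?_ ?_ hκ0 (fun x h0 h1 => (hκ x h0 h1).2) (by norm_num)
    (fun z _ h => norm_inv_den_mul_norm_le h) ?_
  · exact ⟨main.1, main.2.1, main.2.2.2⟩
  · intro r hr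
    constructor
    · simp; nlinarith
    · simp; nlinarith [mul_pos hr he1, mul_pos hr he2]
  · intro r hr hr1
    constructor
    · simp; nlinarith
    · simp; nlinarith
  · intro r hr
    constructor
    · simp [diag_re, diag_im]
      have : 0 ≤ r * (√2 / 2) := by positivity
      nlinarith
    · simp [diag_re, diag_im]; positivity
  · intro r hr x hx0 hx1
    rw [zero_mul, Real.exp_zero, norm_inv]
    refine inv_le_one_of_one_le₀ (one_le_norm_den ?_)
    have h1 := (hκ x hx0 hx1).1
    rw [div_le_iff₀ hκ0] at hr
    have hr0 : 0 ≤ r := by nlinarith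
    rw [add_im, im_ofReal_mul, im_ofReal_mul]
    have : (1 / 2 : ℂ).im = 0 := by norm_num
    rw [this]
    nlinarith [mul_le_mul_of_nonneg_left h1 hr0]

theorem integral_lower {s : ℂ} (hs : s.re ≤ -1) {e : ℂ} (he2 : 0 < e.im) (he3 : e.im ≤ e.re) :
    IntegrableOn (fun r : ℝ => kernel s (1 / 2 + r * -diag) * (den (1 / 2 + r * -diag))⁻¹) (Ioi 0) ∧
    ∫ r in Ioi (0 : ℝ), kernel s (r * -e) * (den (r * -e))⁻¹ * -e =
      (∫ r in Ioc (0 : ℝ) 1, kernel s (r * (1 / 2)) * (den (r * (1 / 2)))⁻¹ * (1 / 2)) +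
        ∫ r in Ioi (0 : ℝ), kernel s (1 / 2 + r * -diag) * (den (1 / 2 + r * -diag))⁻¹ * -diag := by
  have he1 : 0 < e.re := he2.trans_le he3
  have hd1 : 0 < diag.re := by rw [diag_re]; positivity
  have hd2 : 0 < diag.im := by rw [diag_im]; positivity
  obtain ⟨κ, hκ0, hκ⟩ := exists_le_im_sq_of_pos he1 he2 hd1 hd2
  have hneg : ∀ x : ℝ, (1 - x) * -e + x * -diag = -((1 - x) * e + x * diag) := fun x => by ring
  set k : ℝ := min 1 (e.im / e.re) / 2
  have hk0 : 0 < k := by positivity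
  have hk1 : k < 1 := by
    have := min_le_left 1 (e.im / e.re)
    simp only [k]; linarith
  have hk2 : k * e.re < e.im := by
    have : k < e.im / e.re := by
      have := min_le_right 1 (e.im / e.re)
      have : 0 < e.im / e.re := by positivity
      simp only [k]; linarith
    rwa [lt_div_iff₀ he1] at this
  -- The only real points of U are those of (0, 1). The hypothesis Im e ≤ Re e keeps the ray of
  -- direction -e on the left of the line Re z - Im z = 1.
  set U : Set ℂ := {z | z.re - z.im < 1} ∩ {z | z.im < k * z.re} with hUdef
  have hUo : IsOpen U := (isOpen_lt (by fun_prop) (by fun_prop)).inter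
    (isOpen_lt (by fun_prop) (by fun_prop))
  have hU : Convex ℝ U := by
    rintro x ⟨hx1, hx2⟩ y ⟨hy1, hy2⟩ a b ha hb hab
    simp only [mem_ofPred_eq] at hx1 hx2 hy1 hy2
    have hb' : b = 1 - a := by linarith
    subst hb'
    rcases ha.eq_or_lt with rfl | ha
    · simpa using ⟨hy1, hy2⟩
    constructor <;> simp <;> nlinarith
  have hUs : U ⊆ slitPlane := by
    rintro z ⟨-, hz⟩
    simp only [mem_ofPred_eq] at hz
    rw [mem_slitPlane_iff]
    by_contra! h
    nlinarith [h.1, h.2]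
  have hn : ∀ n : ℤ, (n : ℂ) ∉ U := by
    rintro n ⟨h1, h2⟩
    simp at h1 h2
    have h3 : (n : ℝ) < 1 := h1
    have h4 : (0 : ℝ) < n := by
      by_contra! h
      nlinarith
    have h5 : n < 1 := by exact_mod_cast h3
    have h6 : 0 < n := by exact_mod_cast h4
    omega
  have main := integral_kernel_ray_eq (s := s) hs hU hUo hUs (differentiableOn_inv_den hn)
    (e := -e) (z₀ := 1 / 2) (d := -diag) (κ := κ) (C := Real.exp Real.pi) (δ := 1 / 13) (C' := 0)
    (N := 1 / κ) ?_ ?_ ?_ hκ0 (fun x h0 h1 => by rw [hneg, neg_sq]; exact (hκ x h0 h1).2)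
    (by norm_num) (fun z _ h => norm_inv_den_mul_norm_le h) ?_
  · exact ⟨main.2.1, main.2.2.2⟩
  · intro r hr
    constructor
    · simp; nlinarith [mul_le_mul_of_nonneg_left he3 hr.le]
    · simp; nlinarith
  · intro r hr hr1
    constructor
    · simp; nlinarith
    · simp; positivity
  · intro r hr
    constructor
    · simp [diag_re, diag_im]; linarith
    · simp [diag_re, diag_im]
      have : 0 ≤ r * (√2 / 2) := by positivity
      nlinarith
  · intro r hr x hx0 hx1
    rw [zero_mul, Real.exp_zero, norm_inv]
    refine inv_le_one_of_one_le₀ ?_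
    rw [← norm_neg, ← den_neg]
    refine one_le_norm_den ?_
    have h1 := (hκ x hx0 hx1).1
    rw [div_le_iff₀ hκ0] at hr
    have hr0 : 0 ≤ r := by nlinarith
    rw [hneg, neg_im, add_im, im_ofReal_mul, im_ofReal_mul, neg_im]
    have : (1 / 2 : ℂ).im = 0 := by norm_num
    rw [this]
    nlinarith [mul_le_mul_of_nonneg_left h1 hr0]

theorem kernel_neg {s z : ℂ} (hz1 : 0 < z.im) :
    kernel s (-z) = exp (Real.pi * I * s) * kernel s z := by
  have hz : z ≠ 0 := by rintro rfl; simp at hz1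
  have hlog : log (-z) = log z - Real.pi * I := by
    rw [log, log, arg_neg_eq_arg_sub_pi_of_im_pos hz1, norm_neg]; push_cast; ring
  rw [kernel, kernel, neg_sq, cpow_def_of_ne_zero hz, cpow_def_of_ne_zero (neg_ne_zero.2 hz),
    hlog]
  simp only [← exp_add]
  congr 1; ring

/-- `R(s)` as an integral along a ray in the first quadrant. -/
theorem R_eq_ray {s : ℂ} (hs : s.re ≤ -1) {e : ℂ} (he2 : 0 < e.im) (he3 : e.im ≤ e.re) :
    R s = -(1 - exp (Real.pi * I * s)) *
      ∫ r in Ioi (0 : ℝ), kernel s (r * e) * (den (r * e))⁻¹ * e := by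
  obtain ⟨-, i1, h1⟩ := integral_upper hs (he2.trans_le he3) he2
  obtain ⟨i2, h2⟩ := integral_lower hs he2 he3
  -- Both `den` and dz change sign under z ↦ -z, so only the factor e^{πis} of the power survives.
  have h3 : ∫ r in Ioi (0 : ℝ), kernel s (r * -e) * (den (r * -e))⁻¹ * -e =
      exp (Real.pi * I * s) * ∫ r in Ioi (0 : ℝ), kernel s (r * e) * (den (r * e))⁻¹ * e := by
    rw [← integral_const_mul]
    refine setIntegral_congr_fun measurableSet_Ioi fun r hr => ?_
    have : 0 < ((r : ℂ) * e).im := by rw [im_ofReal_mul]; exact mul_pos hr he2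
    simp only [mul_neg, kernel_neg this, den_neg, inv_neg]
    ring
  have hR1 : ∀ u : ℝ, integrand s (path u) * dir =
      kernel s (1 / 2 + u * -diag) * (den (1 / 2 + u * -diag))⁻¹ * -diag := fun u => by
    rw [integrand_eq, path, dir_eq]
  have hR : R s = ∫ u : ℝ, kernel s (1 / 2 + u * -diag) * (den (1 / 2 + u * -diag))⁻¹ * -diag := by
    rw [R]; simp_rw [hR1]
  have i1' : IntegrableOn (fun r : ℝ => kernel s (1 / 2 + r * -diag) *
      (den (1 / 2 + r * -diag))⁻¹) (Iic 0) := by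
    have i3 : IntegrableOn (fun r : ℝ => kernel s (1 / 2 + r * diag) *
      (den (1 / 2 + r * diag))⁻¹) (Ici (-0)) := by
      rw [neg_zero, integrableOn_Ici_iff_integrableOn_Ioi]; exact i1
    refine i3.comp_neg_Iic.congr_fun (fun r _ => ?_) measurableSet_Iic
    simp
  have h4 : ∫ u in Iic (0:ℝ), kernel s (1 / 2 + u * -diag) * (den (1 / 2 + u * -diag))⁻¹ * -diag =
      - ∫ r in Ioi (0 : ℝ), kernel s (1 / 2 + r * diag) * (den (1 / 2 + r * diag))⁻¹ * diag := by
    have := integral_comp_neg_Ioi 0 fun u : ℝ =>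
      kernel s (1 / 2 + u * -diag) * (den (1 / 2 + u * -diag))⁻¹ * -diag
    rw [neg_zero] at this
    rw [← this, ← integral_neg]
    refine setIntegral_congr_fun measurableSet_Ioi fun r hr => ?_
    simp
  rw [hR, ← intervalIntegral.integral_Iic_add_Ioi (i1'.mul_const _) (i2.mul_const _), h4]
  rw [h3] at h2
  generalize (∫ r in Ioi (0 : ℝ), kernel s (r * e) * (den (r * e))⁻¹ * e) = J at h1 h2 ⊢
  -- The segment from 0 to 1/2 occurs in both decompositions and cancels.
  rw [eq_sub_of_add_eq' h1.symm, eq_sub_of_add_eq' h2.symm]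
  ring

/-! ### The exponent on the line of steepest descent -/

/-- The exponent `-2π i η² log z + π i (z² + c z)`; its exponential is `z` times the integrand
`z^{-s} e^{π i z²} e^{π i c z}` for `s = 1 + 2π i η²`. -/
noncomputable def expo (η : ℂ) (c : ℝ) (z : ℂ) : ℂ :=
  -(2 * Real.pi * I * η ^ 2) * log z + Real.pi * I * (z ^ 2 + c * z)

theorem kernel_mul_exp_eq {η z : ℂ} (c : ℝ) (hz : z ≠ 0) :
    kernel (1 + 2 * Real.pi * I * η ^ 2) z * exp (Real.pi * I * (c * z)) =
      exp (expo η c z) / z := by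
  rw [kernel, cpow_def_of_ne_zero hz, eq_div_iff hz]
  nth_rewrite 4 [← exp_log hz]
  simp only [← exp_add, expo]
  congr 1; ring

/-- The point with parameter `ρ` on the line of direction `e^{π i/4}` through `η - c/4`. -/
noncomputable def linePt (η : ℂ) (c ρ : ℝ) : ℂ := η - c / 4 + ρ * diag

theorem linePt_sub (η : ℂ) (c ρ : ℝ) : linePt η c ρ - η = -c / 4 + ρ * diag := by
  rw [linePt]; ring

theorem norm_linePt_sub_le {η : ℂ} {c ρ : ℝ} (hc : 0 ≤ c) :
    ‖linePt η c ρ - η‖ ≤ c / 4 + |ρ| := by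
  rw [linePt_sub]
  refine (norm_add_le _ _).trans ?_
  rw [norm_mul, norm_diag, norm_div, norm_neg, norm_real, norm_real, Real.norm_of_nonneg hc]
  simp

/-- Of the total |η|², the shift by c/4 loses at most a quarter, and going back by at most |η|/4
along the line loses at most another quarter. This is why the half-line starts at ρ = -|η|/4: up to
there z stays in a half-plane around η, which controls η/z and the branch of the logarithm. -/
theorem linePt_re_inner {η : ℂ} (h1 : 0 < η.im) (h2 : η.im ≤ η.re) {c ρ : ℝ} (hc0 : 0 ≤ c)
    (hc : c ≤ ‖η‖) (hρ : -(‖η‖ / 4) ≤ ρ) :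
    ‖η‖ ^ 2 / 2 ≤ (linePt η c ρ * (starRingEnd ℂ) η).re := by
  set n := ‖η‖ with hn
  have hn2 : n ^ 2 = η.re ^ 2 + η.im ^ 2 := by
    rw [hn, ← normSq_eq_norm_sq, normSq_apply]; ring
  have hn0 : 0 ≤ n := norm_nonneg _
  have e1 : (linePt η c ρ * (starRingEnd ℂ) η).re =
      n ^ 2 - c / 4 * η.re + ρ * (√2 / 2 * (η.re + η.im)) := by
    rw [hn2]
    simp [linePt, diag_re, diag_im]
    ring
  have hre : η.re ≤ n := re_le_norm η
  have h3 : √2 / 2 * (η.re + η.im) ≤ n := by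
    refine abs_le_of_sq_le_sq' ?_ hn0 |>.2
    rw [mul_pow, div_pow, Real.sq_sqrt (by norm_num), hn2]
    nlinarith [sq_nonneg (η.re - η.im)]
  have h4 : 0 ≤ √2 / 2 * (η.re + η.im) := by
    have : 0 < η.re := h1.trans_le h2
    positivity
  rw [e1]
  have h5 : c * η.re ≤ n * n := mul_le_mul hc hre (h1.trans_le h2).le hn0
  have h6 : -(n / 4) * (√2 / 2 * (η.re + η.im)) ≤ ρ * (√2 / 2 * (η.re + η.im)) :=
    mul_le_mul_of_nonneg_right hρ h4
  nlinarith

theorem linePt_facts {η : ℂ} (h1 : 0 < η.im) (h2 : η.im ≤ η.re) {c ρ : ℝ} (hc0 : 0 ≤ c)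
    (hc : c ≤ ‖η‖) (hρ : -(‖η‖ / 4) ≤ ρ) :
    0 < (linePt η c ρ).re + (linePt η c ρ).im ∧ 0 ≤ (η / linePt η c ρ).re ∧
      ‖η / linePt η c ρ‖ ≤ 2 ∧ 0 < (linePt η c ρ / η).re := by
  have hin := linePt_re_inner h1 h2 hc0 hc hρ
  set z := linePt η c ρ with hz
  have hη0 : η ≠ 0 := by rintro rfl; simp at h1
  have hn0 : 0 < ‖η‖ := norm_pos_iff.2 hη0
  have hz0 : z ≠ 0 := by
    intro h; rw [h] at hin; simp at hin; nlinarith [pow_pos hn0 2]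
  have e1 : (η / z).re = (z * (starRingEnd ℂ) η).re / ‖z‖ ^ 2 := by
    rw [div_re, ← normSq_eq_norm_sq]; simp; ring
  have e2 : (z / η).re = (z * (starRingEnd ℂ) η).re / ‖η‖ ^ 2 := by
    rw [div_re, ← normSq_eq_norm_sq]; simp; ring
  have hpos : 0 < (z * (starRingEnd ℂ) η).re := lt_of_lt_of_le (by positivity) hin
  refine ⟨?_, ?_, ?_, ?_⟩
  · have hab : ‖η‖ ≤ η.re + η.im := by
      have := norm_le_abs_re_add_abs_im η
      rwa [abs_of_pos h1, abs_of_pos (h1.trans_le h2)] at this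
    have e3 : z.re + z.im = η.re + η.im - c / 4 + ρ * √2 := by
      simp [hz, linePt, diag_re, diag_im]; ring
    have hs : √2 < 1.5 := by rw [Real.sqrt_lt' (by norm_num)]; norm_num
    have hs0 : 0 < √2 := by positivity
    rw [e3]
    have := mul_le_mul_of_nonneg_right hρ hs0.le
    nlinarith
  · rw [e1]; positivity
  · rw [norm_div, div_le_iff₀ (norm_pos_iff.2 hz0)]
    have h3 := hin.trans (re_le_norm _)
    rw [norm_mul, RCLike.norm_conj] at h3
    have : ‖η‖ * ‖η‖ ≤ ‖η‖ * (2 * ‖z‖) := by nlinarith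
    exact le_of_mul_le_mul_left this hn0
  · rw [e2]; positivity

/-- The derivative of the exponent in z is 2πi(z - η)(1 + η/z) + πic. Inserting z - η = ρ e^{πi/4} -
c/4 separates a term of sign opposite to ρ from a perturbation of size O(c). -/
theorem hasDerivAt_expo_linePt {η : ℂ} {c ρ : ℝ} (h : 0 < (linePt η c ρ).re + (linePt η c ρ).im) :
    HasDerivAt (fun ρ : ℝ => (expo η c (linePt η c ρ)).re)
      (-(2 * Real.pi * ρ * (1 + (η / linePt η c ρ).re)) +
        (diag * I * (Real.pi * c / 2) * (1 - η / linePt η c ρ)).re) ρ := by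
  have hslit : linePt η c ρ ∈ slitPlane := by
    rw [mem_slitPlane_iff]; by_contra! h'; linarith [h'.1, h'.2]
  have hz0 : linePt η c ρ ≠ 0 := slitPlane_ne_zero hslit
  have hl : HasDerivAt (fun ρ : ℝ => linePt η c ρ) diag ρ := by
    simpa [linePt] using ((ofRealCLM.hasDerivAt (x := ρ)).mul_const diag).const_add (η - c / 4)
  have hE : HasDerivAt (expo η c) (-(2 * Real.pi * I * η ^ 2) * (linePt η c ρ)⁻¹ +
      Real.pi * I * (2 * linePt η c ρ + c)) (linePt η c ρ) := by
    unfold expo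
    refine ((hasDerivAt_log hslit).const_mul _).add (HasDerivAt.const_mul _ ?_)
    exact ((hasDerivAt_pow 2 (linePt η c ρ)).add
      ((hasDerivAt_id (linePt η c ρ)).const_mul (c:ℂ))).congr_deriv (by simp)
  have h3 := (hE.comp ρ hl)
  have h4 := reCLM.hasFDerivAt.comp_hasDerivAt ρ h3
  refine h4.congr_deriv ?_
  rw [reCLM_apply]
  have e1 : (-(2 * Real.pi * I * η ^ 2) * (linePt η c ρ)⁻¹ +
      Real.pi * I * (2 * linePt η c ρ + c)) * diag =
      ((-(2 * Real.pi * ρ) : ℝ) : ℂ) * (1 + η / linePt η c ρ) +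
        diag * I * (Real.pi * c / 2) * (1 - η / linePt η c ρ) := by
    have hs := linePt_sub η c ρ
    have hd := diag_sq
    have hI : (I : ℂ) ^ 2 = -1 := I_sq
    generalize linePt η c ρ = z at *
    have hη : (ρ : ℂ) * diag = z - η + c / 4 := by rw [hs]; ring
    have e2 : (ρ : ℂ) = -(I * diag) * (z - η + c / 4) := by
      rw [← hη]
      calc (ρ : ℂ) = -(I * I) * ρ := by rw [I_mul_I]; ring
        _ = -(I * diag ^ 2) * ρ := by rw [hd]
        _ = _ := by ring
    push_cast
    rw [e2]
    field_simp
    ring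
  rw [e1, add_re, re_ofReal_mul]
  simp

/-- Global descent, valid where Taylor's formula is not. As Re(η/z) ≥ 0, the main part of the
derivative is at least as strong as -2πρ, and |1 - η/z| ≤ 3 bounds the rest by (3/2)πc; integration
from 0 gives the claim. -/
theorem expo_linePt_re_le {η : ℂ} (h1 : 0 < η.im) (h2 : η.im ≤ η.re) {c ρ : ℝ} (hc0 : 0 ≤ c)
    (hc : c ≤ ‖η‖) (hρ : -(‖η‖ / 4) ≤ ρ) :
    (expo η c (linePt η c ρ)).re ≤ (expo η c (linePt η c 0)).re - Real.pi * ρ ^ 2 +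
      3 / 2 * Real.pi * c * |ρ| := by
  set m := -(‖η‖ / 4) with hm
  have hm0 : m ≤ 0 := by rw [hm]; linarith [norm_nonneg η]
  have hpi := Real.pi_pos
  have hder : ∀ x : ℝ, m ≤ x → HasDerivAt (fun ρ : ℝ => (expo η c (linePt η c ρ)).re)
      (-(2 * Real.pi * x * (1 + (η / linePt η c x).re)) +
        (diag * I * (Real.pi * c / 2) * (1 - η / linePt η c x)).re) x := fun x hx =>
    hasDerivAt_expo_linePt (linePt_facts h1 h2 hc0 hc hx).1
  have hbd : ∀ x : ℝ, m ≤ x → |(diag * I * (Real.pi * c / 2) * (1 - η / linePt η c x)).re| ≤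
      3 / 2 * Real.pi * c := fun x hx => by
    refine (abs_re_le_norm _).trans ?_
    have h3 : ‖1 - η / linePt η c x‖ ≤ 3 := by
      refine (norm_sub_le _ _).trans ?_
      rw [norm_one]; linarith [(linePt_facts h1 h2 hc0 hc hx).2.2.1]
    have h4 : ‖(Real.pi * c / 2 : ℂ)‖ = Real.pi * c / 2 := by
      rw [norm_div, norm_mul, norm_real, norm_real, Real.norm_of_nonneg hpi.le,
        Real.norm_of_nonneg hc0]; simp
    rw [norm_mul, norm_mul, norm_mul, norm_diag, norm_I, h4]
    have : 0 ≤ Real.pi * c / 2 := by positivity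
    nlinarith
  rcases le_total 0 ρ with hρ0 | hρ0
  · have hd2 : ∀ x : ℝ, 0 ≤ x → HasDerivAt (fun ρ : ℝ => (expo η c (linePt η c ρ)).re +
        (Real.pi * ρ ^ 2 - 3 / 2 * Real.pi * c * ρ)) _ x := fun x hx =>
      (hder x (hm0.trans hx)).add ((((hasDerivAt_id x).pow 2).const_mul Real.pi).sub
        ((hasDerivAt_id x).const_mul (3 / 2 * Real.pi * c)))
    have := antitoneOn_of_deriv_nonpos (convex_Ici (0:ℝ))
      (f := fun ρ : ℝ => (expo η c (linePt η c ρ)).re + (Real.pi * ρ ^ 2 - 3 / 2 * Real.pi * c * ρ))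
      (fun x hx => (hd2 x hx).continuousAt.continuousWithinAt)
      (fun x hx => (hd2 x (interior_subset hx)).differentiableAt.differentiableWithinAt)
      (fun x hx => by
        have hx0 : 0 ≤ x := interior_subset hx
        rw [(hd2 x hx0).deriv]
        have b1 := (abs_le.1 (hbd x (hm0.trans hx0))).2
        have b2 := (linePt_facts h1 h2 hc0 hc (hm0.trans hx0)).2.1
        have b3 : 0 ≤ 2 * Real.pi * x * (η / linePt η c x).re := by positivity
        generalize (diag * I * (Real.pi * c / 2) * (1 - η / linePt η c x)).re = Q at b1 ⊢
        simp
        nlinarith)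
    have := this (mem_Ici.2 le_rfl) (mem_Ici.2 hρ0) hρ0
    simp at this
    rw [abs_of_nonneg hρ0]
    linarith
  · have hd2 : ∀ x : ℝ, m ≤ x → HasDerivAt (fun ρ : ℝ => (expo η c (linePt η c ρ)).re +
        (Real.pi * ρ ^ 2 + 3 / 2 * Real.pi * c * ρ)) _ x := fun x hx =>
      (hder x hx).add ((((hasDerivAt_id x).pow 2).const_mul Real.pi).add
        ((hasDerivAt_id x).const_mul (3 / 2 * Real.pi * c)))
    have := monotoneOn_of_deriv_nonneg (convex_Icc m (0:ℝ))
      (f := fun ρ : ℝ => (expo η c (linePt η c ρ)).re + (Real.pi * ρ ^ 2 + 3 / 2 * Real.pi * c * ρ))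
      (fun x hx => (hd2 x hx.1).continuousAt.continuousWithinAt)
      (fun x hx => (hd2 x (interior_subset hx).1).differentiableAt.differentiableWithinAt)
      (fun x hx => by
        obtain ⟨hx0, hx1⟩ := interior_subset hx
        rw [(hd2 x hx0).deriv]
        have b1 := (abs_le.1 (hbd x hx0)).1
        have b2 := (linePt_facts h1 h2 hc0 hc hx0).2.1
        have b3 : 0 ≤ 2 * Real.pi * (-x) * (η / linePt η c x).re := by
          have : 0 ≤ -x := by linarith
          positivity
        generalize (diag * I * (Real.pi * c / 2) * (1 - η / linePt η c x)).re = Q at b1 ⊢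
        simp
        nlinarith)
    have := this ⟨hρ, hρ0⟩ ⟨hm0, le_rfl⟩ hρ0
    simp at this
    rw [abs_of_nonpos hρ0]
    linarith

/-- To second order in w = z - η the exponent changes by 2πiw² + πicw = 2πi(w + c/4)² - πic²/8. The
shift c/4 in `linePt` completes this square, and w + c/4 = ρ e^{πi/4} turns it into -2πρ². The error
is the cubic remainder of the logarithm, with 4π/3 ≤ 5. -/
theorem norm_expo_sub_le {η : ℂ} (h1 : 0 < η.im) (h2 : η.im ≤ η.re) {c ρ : ℝ} (hc0 : 0 ≤ c)
    (hc : c ≤ ‖η‖) (hρ : -(‖η‖ / 4) ≤ ρ) (hu : c / 4 + |ρ| ≤ ‖η‖ / 2) :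
    ‖expo η c (linePt η c ρ) - expo η c η - (-(2 * Real.pi * ρ ^ 2) - Real.pi * I * c ^ 2 / 8)‖ ≤
      5 * (c / 4 + |ρ|) ^ 3 / ‖η‖ := by
  have hη0 : η ≠ 0 := by rintro rfl; simp at h1
  have hn0 : 0 < ‖η‖ := norm_pos_iff.2 hη0
  obtain ⟨-, -, -, hre⟩ := linePt_facts h1 h2 hc0 hc hρ
  have hzs := linePt_sub η c ρ
  have hle := norm_linePt_sub_le (η := η) (ρ := ρ) hc0
  set z := linePt η c ρ with hz
  set u := (z - η) / η with hudef
  have huz : z / η = 1 + u := by rw [hudef]; field_simp; ring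
  have hzu : z = η * (1 + u) := by rw [← huz]; field_simp
  have hηu : η * u = -c / 4 + ρ * diag := by rw [← hzs, hudef]; field_simp
  have hun : ‖u‖ ≤ (c / 4 + |ρ|) / ‖η‖ := by
    rw [hudef, norm_div]; gcongr
  have hu2 : ‖u‖ ≤ 1 / 2 := hun.trans (by rw [div_le_iff₀ hn0]; linarith)
  rw [huz] at hre
  have h1u : (1 + u) ≠ 0 := by intro h; rw [h] at hre; simp at hre
  have hlog : log z = log η + log (1 + u) := by
    rw [hzu]
    refine log_mul hη0 h1u ?_
    have a1 := abs_arg_lt_pi_div_two_iff.2 (Or.inl (h1.trans_le h2))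
    have a2 := abs_arg_lt_pi_div_two_iff.2 (Or.inl hre)
    rw [abs_lt] at a1 a2
    constructor <;> linarith [a1.1, a1.2, a2.1, a2.2]
  have hT := norm_log_sub_logTaylor_le 2 (z := u) (by linarith)
  have hTe : logTaylor (2 + 1) u = u - u ^ 2 / 2 := by
    simp [logTaylor_succ, logTaylor_zero]; ring
  rw [hTe] at hT
  have key : expo η c z - expo η c η - (-(2 * Real.pi * ρ ^ 2) - Real.pi * I * c ^ 2 / 8) =
      -(2 * Real.pi * I * η ^ 2) * (log (1 + u) - (u - u ^ 2 / 2)) := by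
    have e0 : expo η c z - expo η c η = -(2 * Real.pi * I * η ^ 2) * (log (1 + u) - (u - u ^ 2 / 2))
        + 2 * Real.pi * I * (η * u) ^ 2 + Real.pi * I * c * (η * u) := by
      rw [expo, expo, hlog, hzu]; ring
    rw [e0, hηu]
    linear_combination (2 * Real.pi * I * ρ ^ 2) * diag_sq + 2 * Real.pi * ρ ^ 2 * I_sq
  rw [key, norm_mul, norm_neg]
  have e1 : ‖2 * Real.pi * I * η ^ 2‖ = 2 * Real.pi * ‖η‖ ^ 2 := by
    simp [abs_of_pos Real.pi_pos]
  rw [e1]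
  have h3 : (1 - ‖u‖)⁻¹ ≤ 2 := by
    rw [inv_le_comm₀ (by linarith) (by norm_num)]; linarith
  calc 2 * Real.pi * ‖η‖ ^ 2 * ‖log (1 + u) - (u - u ^ 2 / 2)‖
      ≤ 2 * Real.pi * ‖η‖ ^ 2 * (‖u‖ ^ 3 * 2 / 3) := by
        have := Real.pi_pos
        gcongr
        refine hT.trans ?_
        norm_num
        gcongr
    _ ≤ 2 * Real.pi * ‖η‖ ^ 2 * (((c / 4 + |ρ|) / ‖η‖) ^ 3 * 2 / 3) := by
        have := Real.pi_pos
        gcongr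
    _ = (4 * Real.pi / 3) * ((c / 4 + |ρ|) ^ 3 / ‖η‖) := by field_simp; ring
    _ ≤ 5 * ((c / 4 + |ρ|) ^ 3 / ‖η‖) := by
        have := Real.pi_lt_d2
        gcongr
        linarith
    _ = _ := by ring

/-! ### Comparison with a Gaussian -/

/-- The Gaussian `e^{-2πρ² - πi c²/8}` approximating the normalized integrand. -/
noncomputable def gauss (c ρ : ℝ) : ℂ := exp (-(2 * Real.pi * ρ ^ 2) - Real.pi * I * c ^ 2 / 8)

theorem norm_gauss (c ρ : ℝ) : ‖gauss c ρ‖ = Real.exp (-(2 * Real.pi * ρ ^ 2)) := by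
  rw [gauss, norm_exp]; congr 1
  have h1 : (Real.pi * I * c ^ 2 / 8 : ℂ) = ((Real.pi * c ^ 2 / 8 : ℝ) : ℂ) * I := by push_cast; ring
  have h2 : (-(2 * Real.pi * ρ ^ 2) : ℂ) = ((-(2 * Real.pi * ρ ^ 2) : ℝ) : ℂ) := by push_cast; ring
  rw [h1, h2, sub_re, ofReal_re, re_ofReal_mul, I_re]; ring

theorem gauss_eq (c ρ : ℝ) :
    gauss c ρ = exp (-(Real.pi * I * c ^ 2 / 8)) * exp (-(2 * Real.pi : ℝ) * (ρ : ℂ) ^ 2) := by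
  rw [gauss, ← exp_add]; congr 1; push_cast; ring

theorem integral_gauss (c : ℝ) :
    ∫ ρ : ℝ, gauss c ρ = exp (-(Real.pi * I * c ^ 2 / 8)) / (√2 : ℝ) := by
  simp_rw [gauss_eq]
  rw [integral_const_mul]
  have h : ∀ ρ : ℝ, exp (-(2 * Real.pi : ℝ) * (ρ : ℂ) ^ 2) =
      ((Real.exp (-(2 * Real.pi) * ρ ^ 2) : ℝ) : ℂ) := fun ρ => by push_cast; rfl
  simp_rw [h]
  rw [integral_complex_ofReal, integral_gaussian]
  have : Real.pi / (2 * Real.pi) = 2⁻¹ := by field_simp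
  rw [this, Real.sqrt_inv, div_eq_mul_inv]
  push_cast; rfl

theorem integrable_gauss (c : ℝ) : Integrable (gauss c) := by
  have h := (integrable_exp_neg_mul_sq (b := 2 * Real.pi) (by positivity)).ofReal (𝕜 := ℂ)
  refine (h.const_mul (exp (-(Real.pi * I * c ^ 2 / 8)))).congr (ae_of_all _ fun ρ => ?_)
  simp only [gauss_eq]
  congr 1
  simp

theorem norm_expo_ratio_le {η : ℂ} (h1 : 0 < η.im) (h2 : η.im ≤ η.re) {L : ℝ} (hL : 100 ≤ L)
    (hηL : ‖η‖ = L ^ 5) {c ρ : ℝ} (hc0 : 0 ≤ c) (hc : c ≤ L) (hρ : -(‖η‖ / 4) ≤ ρ) :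
    ‖exp (expo η c (linePt η c ρ) - expo η c η)‖ ≤
      3 * Real.exp (-(Real.pi * ρ ^ 2) + 3 / 2 * Real.pi * c * |ρ|) := by
  have hL5 : L ≤ L ^ 5 := le_self_pow₀ (by linarith) (by norm_num)
  have hL3 : 100 * L ≤ L ^ 5 := by
    calc 100 * L ≤ L ^ 4 * L := by
          gcongr; exact hL.trans (le_self_pow₀ (by linarith) (by norm_num))
      _ = L ^ 5 := by ring
  have hcη : c ≤ ‖η‖ := by rw [hηL]; linarith
  have hη0 : 0 ≤ ‖η‖ := norm_nonneg _
  have a1 := expo_linePt_re_le h1 h2 hc0 hcη hρ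
  have a2 := norm_expo_sub_le h1 h2 hc0 hcη (ρ := 0) (by linarith) (by rw [abs_zero, hηL]; linarith)
  have a3 : 5 * (c / 4 + |0|) ^ 3 / ‖η‖ ≤ 1 := by
    rw [abs_zero, add_zero, hηL, div_le_one (by positivity)]
    calc 5 * (c / 4) ^ 3 ≤ 5 * (L / 4) ^ 3 := by gcongr
      _ ≤ L ^ 3 * 1 := by nlinarith [pow_pos (show 0 < L by linarith) 3]
      _ ≤ L ^ 3 * L ^ 2 := by gcongr; exact one_le_pow₀ (by linarith)
      _ = L ^ 5 := by ring
  have a4 := (abs_le.1 ((abs_re_le_norm _).trans (a2.trans a3))).2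
  have e1 : (expo η c (linePt η c 0) - expo η c η -
      (-(2 * Real.pi * (0:ℝ) ^ 2) - Real.pi * I * c ^ 2 / 8)).re =
      (expo η c (linePt η c 0)).re - (expo η c η).re := by
    have h1 : (Real.pi * I * c ^ 2 / 8 : ℂ) = ((Real.pi * c ^ 2 / 8 : ℝ) : ℂ) * I := by push_cast; ring
    rw [h1, sub_re, sub_re, sub_re, re_ofReal_mul, I_re]; simp
  rw [e1] at a4
  rw [norm_exp, sub_re]
  calc Real.exp ((expo η c (linePt η c ρ)).re - (expo η c η).re)
      ≤ Real.exp (1 + (-(Real.pi * ρ ^ 2) + 3 / 2 * Real.pi * c * |ρ|)) := by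
        refine Real.exp_le_exp.2 ?_; linarith
    _ ≤ _ := by
        rw [Real.exp_add]; gcongr
        linarith [Real.exp_one_lt_d9]

theorem exp_neg_le_inv_sq {L x : ℝ} (hL : 0 < L) (h : L ^ 2 ≤ x) : Real.exp (-x) ≤ (L ^ 2)⁻¹ := by
  rw [Real.exp_neg]
  refine inv_anti₀ (by positivity) ?_
  linarith [Real.add_one_le_exp x]

theorem norm_gauss_le_of_large {L : ℝ} (hL : 0 < L) {c ρ : ℝ} (hρ : 6 * L ≤ |ρ|) :
    ‖gauss c ρ‖ ≤ (L ^ 2)⁻¹ * Real.exp (-(Real.pi / 4) * ρ ^ 2) := by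
  have hpi := Real.pi_gt_three
  have h : 36 * L ^ 2 ≤ ρ ^ 2 := by
    rw [← sq_abs ρ]; nlinarith
  calc ‖gauss c ρ‖ ≤ Real.exp (-(Real.pi / 4 * ρ ^ 2)) * Real.exp (-(Real.pi / 4) * ρ ^ 2) := by
        rw [norm_gauss, ← Real.exp_add]
        refine Real.exp_le_exp.2 ?_
        nlinarith [sq_nonneg ρ]
    _ ≤ _ := by
        gcongr
        refine exp_neg_le_inv_sq hL ?_
        nlinarith [sq_nonneg L]

/-- For |ρ| ≤ 6L the cubic remainder is O(L³/|η|) = O(L^{-2}), which is the reason for |η| = L^5.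
Beyond 6L the integrand and the Gaussian are each negligible. The weight e^{-πρ²/4} is kept so that
the bound can be integrated. -/
theorem norm_expo_ratio_sub_gauss_le {η : ℂ} (h1 : 0 < η.im) (h2 : η.im ≤ η.re) {L : ℝ}
    (hL : 100 ≤ L) (hηL : ‖η‖ = L ^ 5) {c ρ : ℝ} (hc0 : 0 ≤ c) (hc : c ≤ L)
    (hρ : -(‖η‖ / 4) ≤ ρ) :
    ‖exp (expo η c (linePt η c ρ) - expo η c η) * (η / linePt η c ρ) - gauss c ρ‖ ≤
      5000 * (L ^ 2)⁻¹ * Real.exp (-(Real.pi / 4) * ρ ^ 2) := by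
  have hL0 : 0 < L := by linarith
  have hL3 : 100 * L ≤ L ^ 5 := by
    calc 100 * L ≤ L ^ 4 * L := by
          gcongr; exact hL.trans (le_self_pow₀ (by linarith) (by norm_num))
      _ = L ^ 5 := by ring
  have hcη : c ≤ ‖η‖ := by rw [hηL]; linarith
  have hη0 : η ≠ 0 := by rintro rfl; simp at h1
  obtain ⟨-, -, hv2, hre⟩ := linePt_facts h1 h2 hc0 hcη hρ
  have hpi := Real.pi_gt_three
  rcases le_total |ρ| (6 * L) with hs | hs
  · have hw : c / 4 + |ρ| ≤ 25 / 4 * L := by linarith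
    have hw0 : 0 ≤ c / 4 + |ρ| := by positivity
    have b1 := norm_expo_sub_le h1 h2 hc0 hcη hρ (by rw [hηL]; linarith)
    set Er := expo η c (linePt η c ρ) - expo η c η - (-(2 * Real.pi * ρ ^ 2) - Real.pi * I * c ^ 2 / 8)
      with hEr
    have b2 : ‖Er‖ ≤ 1225 * (L ^ 2)⁻¹ := by
      refine b1.trans ?_
      rw [hηL, div_le_iff₀ (by positivity)]
      calc 5 * (c / 4 + |ρ|) ^ 3 ≤ 5 * (25 / 4 * L) ^ 3 := by gcongr
        _ ≤ 1225 * L ^ 3 := by nlinarith [pow_pos hL0 3]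
        _ = 1225 * (L ^ 2)⁻¹ * L ^ 5 := by field_simp
    have hLL : (L ^ 2)⁻¹ ≤ 1 / 10000 := by
      rw [inv_le_comm₀ (by positivity) (by norm_num)]; nlinarith
    have b3 : ‖exp Er - 1‖ ≤ 2450 * (L ^ 2)⁻¹ := by
      refine (norm_exp_sub_one_le (by linarith)).trans ?_
      linarith
    have b4 : ‖η / linePt η c ρ - 1‖ ≤ 100 * (L ^ 2)⁻¹ := by
      have hz0 : linePt η c ρ ≠ 0 := by intro h; rw [h] at hre; simp at hre
      have e : η / linePt η c ρ - 1 = -((linePt η c ρ - η) / η) * (η / linePt η c ρ) := by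
        field_simp; ring
      rw [e, norm_mul, norm_neg, norm_div]
      have : ‖linePt η c ρ - η‖ / ‖η‖ ≤ 7 * (L ^ 2)⁻¹ := by
        rw [hηL, div_le_iff₀ (by positivity)]
        calc ‖linePt η c ρ - η‖ ≤ 25 / 4 * L := (norm_linePt_sub_le hc0).trans hw
          _ ≤ 7 * L * 1 := by linarith
          _ ≤ 7 * L * L ^ 2 := by gcongr; exact one_le_pow₀ (by linarith)
          _ = 7 * (L ^ 2)⁻¹ * L ^ 5 := by field_simp
      calc _ ≤ 7 * (L ^ 2)⁻¹ * 2 := by gcongr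
        _ ≤ _ := by nlinarith [inv_pos.2 (pow_pos hL0 2)]
    have e2 : exp (expo η c (linePt η c ρ) - expo η c η) * (η / linePt η c ρ) - gauss c ρ =
        gauss c ρ * ((exp Er - 1) * (η / linePt η c ρ) + (η / linePt η c ρ - 1)) := by
      have : exp (expo η c (linePt η c ρ) - expo η c η) = gauss c ρ * exp Er := by
        rw [gauss, ← exp_add, hEr]; congr 1; ring
      rw [this]; ring
    rw [e2, norm_mul, norm_gauss]
    have b5 : ‖(exp Er - 1) * (η / linePt η c ρ) + (η / linePt η c ρ - 1)‖ ≤ 5000 * (L ^ 2)⁻¹ := by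
      refine (norm_add_le _ _).trans ?_
      rw [norm_mul]
      calc _ ≤ 2450 * (L ^ 2)⁻¹ * 2 + 100 * (L ^ 2)⁻¹ := by gcongr
        _ = _ := by ring
    rw [mul_comm]
    gcongr
    nlinarith [sq_nonneg ρ]
  -- The factor 6 gives c|ρ| ≤ ρ²/6, hence a cross term of at most πρ²/4 against the descent πρ².
  · have c1 := norm_expo_ratio_le h1 h2 hL hηL hc0 hc hρ
    have h36 : 36 * L ^ 2 ≤ ρ ^ 2 := by
      rw [← sq_abs ρ]; nlinarith
    have c2 : Real.exp (-(Real.pi * ρ ^ 2) + 3 / 2 * Real.pi * c * |ρ|) ≤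
        (L ^ 2)⁻¹ * Real.exp (-(Real.pi / 4) * ρ ^ 2) := by
      calc _ ≤ Real.exp (-(Real.pi / 4 * ρ ^ 2)) * Real.exp (-(Real.pi / 4) * ρ ^ 2) := by
            rw [← Real.exp_add]
            refine Real.exp_le_exp.2 ?_
            have : c * |ρ| ≤ ρ ^ 2 / 6 := by
              rw [← sq_abs ρ]; nlinarith [abs_nonneg ρ]
            nlinarith [sq_nonneg ρ]
        _ ≤ _ := by
            gcongr
            refine exp_neg_le_inv_sq hL0 ?_
            nlinarith [sq_nonneg L]
    have c3 := norm_gauss_le_of_large hL0 (c := c) hs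
    have c4 : 0 < (L ^ 2)⁻¹ * Real.exp (-(Real.pi / 4) * ρ ^ 2) := by positivity
    refine (norm_sub_le _ _).trans ?_
    rw [norm_mul]
    calc _ ≤ (3 * ((L ^ 2)⁻¹ * Real.exp (-(Real.pi / 4) * ρ ^ 2))) * 2 +
          (L ^ 2)⁻¹ * Real.exp (-(Real.pi / 4) * ρ ^ 2) := by
          gcongr
          exact c1.trans (by gcongr)
      _ ≤ _ := by nlinarith

theorem integrable_exp_shift (x₀ : ℝ) :
    Integrable fun r : ℝ => Real.exp (-(Real.pi / 4) * (r - x₀) ^ 2) :=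
  (integrable_exp_neg_mul_sq (b := Real.pi / 4) (by positivity)).comp_sub_right x₀

theorem integral_exp_shift (x₀ : ℝ) :
    ∫ r : ℝ, Real.exp (-(Real.pi / 4) * (r - x₀) ^ 2) = 2 := by
  rw [integral_sub_right_eq_self (fun r : ℝ => Real.exp (-(Real.pi / 4) * r ^ 2)) x₀,
    integral_gaussian]
  have : Real.pi / (Real.pi / 4) = 2 ^ 2 := by field_simp; norm_num
  rw [this, Real.sqrt_sq (by norm_num)]

/-- Contribution of the half-line of direction `e^{πi/4}` through `η - c/4`. -/
theorem norm_integral_halfLine_sub_le {η : ℂ} (h1 : 0 < η.im) (h2 : η.im ≤ η.re) {L : ℝ}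
    (hL : 100 ≤ L) (hηL : ‖η‖ = L ^ 5) {c : ℝ} (hc0 : 0 ≤ c) (hc : c ≤ L)
    {f : ℝ → ℂ} (hf : IntegrableOn f (Ioi 0))
    (hfe : ∀ r, 0 < r → f r = exp (expo η c (linePt η c (r - ‖η‖ / 4)) - expo η c η) *
      (η / linePt η c (r - ‖η‖ / 4))) :
    ‖(∫ r in Ioi (0:ℝ), f r) - exp (-(Real.pi * I * c ^ 2 / 8)) / (√2 : ℝ)‖ ≤
      10000 * (L ^ 2)⁻¹ := by
  have hL0 : 0 < L := by linarith
  set x₀ := ‖η‖ / 4 with hx₀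
  have hg : Integrable fun r => gauss c (r - x₀) := (integrable_gauss c).comp_sub_right x₀
  rw [← integral_gauss, ← integral_sub_right_eq_self (gauss c) x₀,
    ← integral_indicator measurableSet_Ioi, ← integral_sub (hf.integrable_indicator measurableSet_Ioi) hg]
  have hb : Integrable fun r => 5000 * (L ^ 2)⁻¹ * Real.exp (-(Real.pi / 4) * (r - x₀) ^ 2) :=
    (integrable_exp_shift x₀).const_mul _
  refine (norm_integral_le_of_norm_le hb (ae_of_all _ fun r => ?_)).trans ?_
  · by_cases hr : 0 < r
    · rw [indicator_of_mem (mem_Ioi.2 hr), hfe r hr]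
      exact norm_expo_ratio_sub_gauss_le h1 h2 hL hηL hc0 hc (by linarith)
    -- The Gaussian is integrated over the whole line; the part before the start of the half-line is
    -- at distance at least |η|/4 ≥ 6L from its peak.
    · rw [indicator_of_notMem (by simpa using hr), zero_sub, norm_neg]
      have h3 : 100 * L ≤ L ^ 5 := by
        calc 100 * L ≤ L ^ 4 * L := by
              gcongr; exact hL.trans (le_self_pow₀ (by linarith) (by norm_num))
          _ = L ^ 5 := by ring
      refine (norm_gauss_le_of_large hL0 ?_).trans ?_
      · rw [abs_of_nonpos (by linarith [norm_nonneg η]), hx₀, hηL]; linarith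
      · have : 0 < (L ^ 2)⁻¹ * Real.exp (-(Real.pi / 4) * (r - x₀) ^ 2) := by positivity
        linarith
  · rw [integral_const_mul, integral_exp_shift]; linarith

/-! ### The segment from 0 and the saddle point formula -/

/-- For x + iy the starting point of the half-line and a + ib the saddle, the shift cancels: 4x + c
= 4(a - m) with m = n√2/8. If y ≥ 0 then b ≥ m ≥ 10 and the gain 4bm suffices; if y ≤ 0 the left
side is not positive. -/
theorem pi_mul_le_of_shift {x y a b n c τ : ℝ} (hx0 : 0 ≤ x) (hx : x = a - c / 4 - n * √2 / 8)
    (hy : y = b - n * √2 / 8) (hn : 10 ≤ n * √2 / 8) (hc : 0 ≤ c) (hτ0 : 0 ≤ τ) (hτ1 : τ ≤ 1)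
    (hb : 0 ≤ b) (hN : 2 ≤ 4 * Real.pi * (a * b)) :
    Real.pi * ((1 + τ) * (2 * (x * y)) + c * y) ≤ 4 * Real.pi * (a * b) - 1 := by
  have hpi := Real.pi_gt_three
  set m := n * √2 / 8
  rcases le_total y 0 with hy0 | hy0
  · have h3 := mul_nonpos_of_nonneg_of_nonpos hx0 hy0
    have h4 := mul_nonpos_of_nonneg_of_nonpos hc hy0
    have h5 := mul_nonpos_of_nonneg_of_nonpos hτ0 h3
    have : (1 + τ) * (2 * (x * y)) + c * y ≤ 0 := by linarith
    have := mul_nonpos_of_nonneg_of_nonpos Real.pi_pos.le this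
    linarith
  · have h3 := mul_nonneg hx0 hy0
    have h4 := mul_le_mul_of_nonneg_right hτ1 h3
    have h5 : y * (4 * x + c) ≤ b * (4 * x + c) :=
      mul_le_mul_of_nonneg_right (by linarith) (by linarith)
    have h6 : b * (4 * x + c) = 4 * (a * b) - 4 * (b * m) := by rw [hx]; ring
    have h7 : 10 * 10 ≤ b * m := mul_le_mul (by linarith) hn (by norm_num) hb
    have h8 : (1 + τ) * (2 * (x * y)) + c * y ≤ 4 * (a * b) - 1 := by linarith
    have h9 := mul_le_mul_of_nonneg_left h8 Real.pi_pos.le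
    linarith

/-- With N = 4π Re η Im η, the logarithm of the ratio of the two sides is at most (N - 1)(log τ + 1
- τ) ≤ 0. The integrand on the segment is therefore largest at the end where the half-line begins,
and is already negligible there. -/
theorem norm_segment_le {η : ℂ} (h1 : 0 < η.im) (h2 : η.im ≤ η.re) {L : ℝ}
    (hL : 100 ≤ L) (hηL : ‖η‖ = L ^ 5) (hN : 2 ≤ 4 * Real.pi * (η.re * η.im)) {c : ℝ}
    (hc0 : 0 ≤ c) (hc : c ≤ L) {τ : ℝ} (hτ0 : 0 < τ) (hτ1 : τ ≤ 1) :
    ‖exp (expo η c (τ * linePt η c (-(‖η‖ / 4)))) / (τ * linePt η c (-(‖η‖ / 4)))‖ ≤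
      ‖exp (expo η c (linePt η c (-(‖η‖ / 4)))) / linePt η c (-(‖η‖ / 4))‖ := by
  have hL0 : 0 < L := by linarith
  have hL3 : 100 * L ≤ L ^ 5 := by
    calc 100 * L ≤ L ^ 4 * L := by
          gcongr; exact hL.trans (le_self_pow₀ (by linarith) (by norm_num))
      _ = L ^ 5 := by ring
  have hcη : c ≤ ‖η‖ := by rw [hηL]; linarith
  have hcη' : 100 * c ≤ ‖η‖ := by rw [hηL]; linarith
  have hn100 : 100 ≤ ‖η‖ := by rw [hηL]; linarith
  have hzU := (linePt_facts h1 h2 hc0 hcη (le_refl (-(‖η‖ / 4)))).1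
  set n := ‖η‖ with hn
  have hzre : (linePt η c (-(n / 4))).re = η.re - c / 4 - n * √2 / 8 := by
    simp [linePt, diag_re]; ring
  have hzim : (linePt η c (-(n / 4))).im = η.im - n * √2 / 8 := by
    simp [linePt, diag_im]; ring
  set z := linePt η c (-(n / 4)) with hz
  have hz0 : z ≠ 0 := by rintro h; rw [h] at hzU; simp at hzU
  have hτz : ((τ : ℝ) : ℂ) ≠ 0 := ofReal_ne_zero.2 hτ0.ne'
  have hlog : log (τ * z) = (Real.log τ : ℝ) + log z := by
    rw [log_ofReal_mul hτ0 hz0]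
  have hpi := Real.pi_gt_three
  rw [norm_div, norm_div, norm_mul, norm_exp, norm_exp, norm_real, Real.norm_of_nonneg hτ0.le]
  have hN' : (-(2 * Real.pi * I * η ^ 2)).re = 4 * Real.pi * (η.re * η.im) := by
    have e : -(2 * Real.pi * I * η ^ 2) = ((-(2 * Real.pi) : ℝ) : ℂ) * (I * η ^ 2) := by push_cast; ring
    rw [e, re_ofReal_mul, I_mul_re, sq, mul_im]; ring
  have e1 : (expo η c (τ * z)).re = 4 * Real.pi * (η.re * η.im) * Real.log τ +
      (-(2 * Real.pi * I * η ^ 2) * log z).re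
      - Real.pi * (τ ^ 2 * (2 * (z.re * z.im)) + c * τ * z.im) := by
    rw [expo, hlog, mul_add, add_re, add_re, mul_comm _ ((Real.log τ : ℝ) : ℂ), re_ofReal_mul, hN',
      mul_assoc (Real.pi : ℂ), re_ofReal_mul, I_mul_re, add_im, im_ofReal_mul, im_ofReal_mul, mul_pow,
      ← ofReal_pow, im_ofReal_mul, sq z, mul_im]
    ring
  have e2 : (expo η c z).re = (-(2 * Real.pi * I * η ^ 2) * log z).re
      - Real.pi * (2 * (z.re * z.im) + c * z.im) := by
    rw [expo, add_re, mul_assoc (Real.pi : ℂ), re_ofReal_mul, I_mul_re, add_im, im_ofReal_mul, sq z,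
      mul_im]
    ring
  rw [← div_div]
  gcongr
  rw [div_le_iff₀ hτ0]
  nth_rewrite 2 [← Real.exp_log hτ0]
  rw [← Real.exp_add]
  refine Real.exp_le_exp.2 ?_
  rw [e1, e2]
  have hlt : Real.log τ ≤ τ - 1 := Real.log_le_sub_one_of_pos hτ0
  have hs : √2 < 1.5 := by rw [Real.sqrt_lt' (by norm_num)]; norm_num
  have hs1 : 1.4 < √2 := by rw [Real.lt_sqrt (by norm_num)]; norm_num
  have hn2 : n ^ 2 = η.re ^ 2 + η.im ^ 2 := by
    rw [hn, ← normSq_eq_norm_sq, normSq_apply]; ring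
  have hren : 2 / 3 * n ≤ η.re := by
    refine abs_le_of_sq_le_sq' ?_ (h1.trans_le h2).le |>.2
    nlinarith
  have hx0 : 0 ≤ z.re := by rw [hzre]; nlinarith
  set N := 4 * Real.pi * (η.re * η.im) with hNdef
  have main : Real.pi * ((1 + τ) * (2 * (z.re * z.im)) + c * z.im) ≤ N - 1 :=
    pi_mul_le_of_shift hx0 hzre hzim (by nlinarith) hc0 hτ0.le hτ1 h1.le hN
  have h5 := mul_le_mul_of_nonneg_left main (by linarith : 0 ≤ 1 - τ)
  have h6 : (N - 1) * Real.log τ ≤ (N - 1) * (τ - 1) :=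
    mul_le_mul_of_nonneg_left hlt (by linarith)
  linear_combination h5 + h6

theorem convex_re_add_im_pos : Convex ℝ {z : ℂ | 0 < z.re + z.im} := by
  rintro x hx y hy a b ha hb hab
  simp only [mem_ofPred_eq] at hx hy
  have hb' : b = 1 - a := by linarith
  subst hb'
  rcases ha.eq_or_lt with rfl | ha
  · simpa using hy
  simp
  nlinarith

theorem re_one_add_two_pi_I_mul (η : ℂ) :
    (1 + 2 * Real.pi * I * η ^ 2).re = 1 - 4 * Real.pi * (η.re * η.im) := by
  have e : 2 * Real.pi * I * η ^ 2 = ((2 * Real.pi : ℝ) : ℂ) * (I * η ^ 2) := by push_cast; ring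
  rw [e, add_re, re_ofReal_mul, I_mul_re, sq, mul_im, one_re]; ring

/-- Saddle point asymptotics of `∫ z^{-s} e^{π i z²} e^{π i c z} dz` along a ray in the first
quadrant, where `s = 1 + 2π i η²`, uniformly for `0 ≤ c ≤ |η|^{1/5}`. -/
theorem norm_integral_kernel_sub_le {η : ℂ} (h1 : 0 < η.im) (h2 : η.im ≤ η.re) {L : ℝ}
    (hL : 100 ≤ L) (hηL : ‖η‖ = L ^ 5) (hN : 2 ≤ 4 * Real.pi * (η.re * η.im)) {c : ℝ}
    (hc0 : 0 ≤ c) (hc : c ≤ L) {e : ℂ} (he1 : 0 < e.re) (he2 : 0 < e.im) :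
    IntegrableOn (fun r : ℝ => kernel (1 + 2 * Real.pi * I * η ^ 2) (r * e) *
      exp (Real.pi * I * (c * (r * e)))) (Ioi 0) ∧
    ‖(∫ r in Ioi (0:ℝ), kernel (1 + 2 * Real.pi * I * η ^ 2) (r * e) *
      exp (Real.pi * I * (c * (r * e))) * e) -
      exp (expo η c η) / η * diag * (exp (-(Real.pi * I * c ^ 2 / 8)) / (√2 : ℝ))‖ ≤
      10001 * (L ^ 2)⁻¹ * ‖exp (expo η c η) / η‖ := by
  have hL0 : 0 < L := by linarith
  have hL3 : 100 * L ≤ L ^ 5 := by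
    calc 100 * L ≤ L ^ 4 * L := by
          gcongr; exact hL.trans (le_self_pow₀ (by linarith) (by norm_num))
      _ = L ^ 5 := by ring
  have hcη : c ≤ ‖η‖ := by rw [hηL]; linarith
  have hη0 : η ≠ 0 := by rintro rfl; simp at h1
  have hn0 : 0 < ‖η‖ := norm_pos_iff.2 hη0
  set s := 1 + 2 * Real.pi * I * η ^ 2 with hs
  have hsre : s.re ≤ -1 := by rw [hs, re_one_add_two_pi_I_mul]; linarith
  set U : Set ℂ := {z | 0 < z.re + z.im} with hU
  have hUs : U ⊆ slitPlane := by
    intro z hz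
    simp only [hU, mem_ofPred_eq] at hz
    rw [mem_slitPlane_iff]
    by_contra! h
    linarith [h.1, h.2]
  set z₀ := linePt η c (-(‖η‖ / 4)) with hz₀
  have hline : ∀ r : ℝ, z₀ + r * diag = linePt η c (r - ‖η‖ / 4) := fun r => by
    rw [hz₀, linePt, linePt]; push_cast; ring
  have hlineU : ∀ r : ℝ, 0 ≤ r → linePt η c (r - ‖η‖ / 4) ∈ U := fun r hr =>
    (linePt_facts h1 h2 hc0 hcη (by linarith)).1
  have hz₀U : z₀ ∈ U := (linePt_facts h1 h2 hc0 hcη le_rfl).1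
  have hray : ∀ w ∈ U, ∀ r : ℝ, 0 < r → (r : ℂ) * w ∈ U := fun w hw r hr => by
    simp only [hU, mem_ofPred_eq] at hw ⊢
    rw [re_ofReal_mul, im_ofReal_mul, ← mul_add]; positivity
  have hnz : ∀ w ∈ U, w ≠ 0 := fun w hw => slitPlane_ne_zero (hUs hw)
  obtain ⟨κ, hκ0, hκ⟩ := exists_le_im_sq_of_pos he1 he2 (d := diag)
    (by rw [diag_re]; positivity) (by rw [diag_im]; positivity)
  have hnG : ∀ z : ℂ, ‖exp (Real.pi * I * (c * z))‖ = Real.exp (-(Real.pi * (c * z.im))) := fun z => by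
    rw [norm_exp_pi_I_mul, im_ofReal_mul]
  have hpi := Real.pi_pos
  obtain ⟨i1, i2, i3, i4⟩ := integral_kernel_ray_eq hsre (G := fun z => exp (Real.pi * I * (c * z)))
    (U := U) convex_re_add_im_pos (isOpen_lt (by fun_prop) (by fun_prop)) hUs
    (by fun_prop) (e := e) (z₀ := z₀) (d := diag) (hray e (by simp [hU]; positivity))
    (fun r hr _ => hray z₀ hz₀U r hr) (fun r hr => by rw [hline]; exact hlineU r hr) hκ0
    (fun x hx0 hx1 => (hκ x hx0 hx1).2) (C := Real.exp (Real.pi * c)) (δ := 1)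
    (C' := Real.pi * (c * ‖z₀‖)) (N := 0) one_pos
    (fun z _ hz => by
      rw [hnG]
      have h3 := (abs_le.1 ((abs_im_le_norm z).trans hz.le)).1
      calc _ ≤ Real.exp (-(Real.pi * (c * z.im))) * 1 := by gcongr
        _ ≤ _ := by
          rw [mul_one]
          refine Real.exp_le_exp.2 ?_
          nlinarith [mul_le_mul_of_nonneg_left h3 (mul_nonneg hpi.le hc0)])
    (fun r hr x hx0 hx1 => by
      rw [hnG]
      refine Real.exp_le_exp.2 ?_
      have h3 := (hκ x hx0 hx1).1
      have h4 : -‖z₀‖ ≤ x * z₀.im := by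
        have := (abs_le.1 (abs_im_le_norm z₀)).1
        nlinarith [norm_nonneg z₀]
      rw [add_im, im_ofReal_mul, im_ofReal_mul]
      have h5 : 0 ≤ r * ((1 - x) * e + x * diag : ℂ).im := mul_nonneg hr (hκ0.le.trans h3)
      have h6 : -(r * ((1 - x) * e + x * diag : ℂ).im + x * z₀.im) ≤ ‖z₀‖ * (r + 1) := by
        nlinarith [norm_nonneg z₀]
      nlinarith [mul_le_mul_of_nonneg_left h6 (mul_nonneg hpi.le hc0)])
  refine ⟨i1, ?_⟩
  rw [i4]
  set P := exp (expo η c η) / η with hP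
  have hP0 : P ≠ 0 := div_ne_zero (exp_ne_zero _) hη0
  have hF : ∀ w ∈ U, kernel s w * exp (Real.pi * I * (c * w)) = exp (expo η c w) / w := fun w hw =>
    kernel_mul_exp_eq c (hnz w hw)
  have hratio : ∀ w ∈ U, exp (expo η c w) / w = P * (exp (expo η c w - expo η c η) * (η / w)) :=
    fun w hw => by
      rw [exp_sub, hP]
      have := hnz w hw
      have := exp_ne_zero (expo η c η)
      field_simp
  -- the half-line
  have hint : ∫ r in Ioi (0:ℝ), kernel s (z₀ + r * diag) * exp (Real.pi * I * (c * (z₀ + r * diag))) *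
      diag = P * diag * ∫ r in Ioi (0:ℝ), exp (expo η c (linePt η c (r - ‖η‖ / 4)) - expo η c η) *
        (η / linePt η c (r - ‖η‖ / 4)) := by
    rw [← integral_const_mul]
    refine setIntegral_congr_fun measurableSet_Ioi fun r hr => ?_
    simp only [hline]
    rw [hF _ (hlineU r (mem_Ioi.1 hr).le), hratio _ (hlineU r (mem_Ioi.1 hr).le)]
    ring
  have hfi : IntegrableOn (fun r : ℝ => exp (expo η c (linePt η c (r - ‖η‖ / 4)) - expo η c η) *
        (η / linePt η c (r - ‖η‖ / 4))) (Ioi 0) := by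
    refine IntegrableOn.congr_fun (i2.const_mul P⁻¹) (fun r hr => ?_) measurableSet_Ioi
    simp only [hline]
    rw [hF _ (hlineU r (mem_Ioi.1 hr).le), hratio _ (hlineU r (mem_Ioi.1 hr).le),
      inv_mul_cancel_left₀ hP0]
  have hhalf := norm_integral_halfLine_sub_le h1 h2 hL hηL hc0 hc hfi fun r _ => rfl
  -- the segment
  have hseg : ‖∫ r in Ioc (0:ℝ) 1, kernel s (r * z₀) * exp (Real.pi * I * (c * (r * z₀))) * z₀‖ ≤
      (L ^ 2)⁻¹ * ‖P‖ := by
    have hb : ∀ r ∈ Ioc (0:ℝ) 1, ‖kernel s (r * z₀) * exp (Real.pi * I * (c * (r * z₀))) * z₀‖ ≤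
        (L ^ 2)⁻¹ * ‖P‖ := by
      intro r hr
      rw [hF _ (hray z₀ hz₀U r hr.1), norm_mul]
      have hz0 : 0 < ‖z₀‖ := norm_pos_iff.2 (hnz z₀ hz₀U)
      refine (mul_le_mul_of_nonneg_right (norm_segment_le h1 h2 hL hηL hN hc0 hc hr.1 hr.2)
        hz0.le).trans ?_
      rw [← hz₀, norm_div, div_mul_cancel₀ _ hz0.ne']
      have e1 : exp (expo η c z₀) = exp (expo η c z₀ - expo η c η) * (P * η) := by
        rw [exp_sub, hP]
        have := exp_ne_zero (expo η c η)
        field_simp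
      have b1 := norm_expo_ratio_le h1 h2 hL hηL hc0 hc (le_refl (-(‖η‖ / 4)))
      rw [e1, norm_mul, norm_mul]
      -- At ρ = -|η|/4 the descent is π|η|²/16, and the cross term is small against it because c ≤
      -- |η|/100.
      have b2 : -(Real.pi * (-(‖η‖ / 4)) ^ 2) + 3 / 2 * Real.pi * c * |-(‖η‖ / 4)| ≤
          -(‖η‖ ^ 2 / 8) := by
        rw [abs_neg, abs_of_pos (by positivity)]
        have b4 : c * ‖η‖ ≤ ‖η‖ ^ 2 / 100 := by
          have : 100 * c ≤ ‖η‖ := by rw [hηL]; linarith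
          nlinarith
        have b3 := Real.pi_gt_three
        have b5 : Real.pi * (c * ‖η‖) ≤ Real.pi * (‖η‖ ^ 2 / 100) := by gcongr
        nlinarith [sq_nonneg ‖η‖]
      have b3 : Real.exp (-(‖η‖ ^ 2 / 8)) ≤ 8 / ‖η‖ ^ 2 := by
        rw [Real.exp_neg, ← inv_div (‖η‖ ^ 2) 8]
        refine inv_anti₀ (by positivity) ?_
        linarith [Real.add_one_le_exp (‖η‖ ^ 2 / 8)]
      calc _ ≤ 3 * (8 / ‖η‖ ^ 2) * (‖P‖ * ‖η‖) := by
            gcongr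
            refine b1.trans ?_
            gcongr
            exact (Real.exp_le_exp.2 b2).trans b3
        _ = 24 / ‖η‖ * ‖P‖ := by field_simp; ring
        _ ≤ (L ^ 2)⁻¹ * ‖P‖ := by
            gcongr
            rw [div_le_iff₀ hn0, hηL]
            have : (L ^ 2)⁻¹ * L ^ 5 = L ^ 3 := by field_simp
            rw [this]
            have : L ≤ L ^ 3 := le_self_pow₀ (by linarith) (by norm_num)
            linarith
    have := norm_setIntegral_le_of_norm_le_const (μ := volume) (s := Ioc (0:ℝ) 1) (by simp) hb
    simpa using this
  rw [hint]
  have e1 : ∀ A B : ℂ, A + P * diag * B - P * diag * (exp (-(Real.pi * I * c ^ 2 / 8)) / (√2 : ℝ)) =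
      A + P * diag * (B - exp (-(Real.pi * I * c ^ 2 / 8)) / (√2 : ℝ)) := fun A B => by ring
  rw [e1]
  refine (norm_add_le _ _).trans ?_
  rw [norm_mul (P * diag), norm_mul P, norm_diag, mul_one]
  have := mul_le_mul_of_nonneg_left hhalf (norm_nonneg P)
  linarith

/-! ### Geometric expansion, phases and tail -/

/-- With x = e^{πiz} the left side is x/(1 - x²). The expansion is stopped after K terms, because
the saddle point formula is uniform only for bounded frequencies. -/
theorem neg_inv_den_eq {z : ℂ} (hz : 0 < z.im) (K : ℕ) :
    -(den z)⁻¹ = (∑ k ∈ Finset.range K, exp (Real.pi * I * (((2 * k + 1 : ℕ) : ℝ) * z))) +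
      exp (Real.pi * I * z) ^ (2 * K + 1) / (1 - exp (Real.pi * I * z) ^ 2) := by
  set x := exp (Real.pi * I * z) with hx
  have hx0 : x ≠ 0 := exp_ne_zero _
  have hxn : ‖x‖ < 1 := by
    rw [hx, norm_exp_pi_I_mul]
    exact Real.exp_lt_one_iff.2 (by have := Real.pi_pos; nlinarith [mul_pos this hz])
  have hx2 : 1 - x ^ 2 ≠ 0 := by
    intro h
    have h2 : ‖x ^ 2‖ = 1 := by rw [← sub_eq_zero.1 h, norm_one]
    rw [norm_pow] at h2
    nlinarith [norm_nonneg x]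
  have hpow : ∀ k : ℕ, exp (Real.pi * I * (((2 * k + 1 : ℕ) : ℝ) * z)) = x * (x ^ 2) ^ k := fun k => by
    rw [← pow_mul, ← pow_succ', hx, ← exp_nat_mul]; congr 1; push_cast; ring
  have hden : den z = x - x⁻¹ := by rw [den, hx, exp_neg]
  simp_rw [hpow]
  rw [← Finset.mul_sum, hden]
  have hgeom := geom_sum_mul (x ^ 2) K
  have hsum : ∑ i ∈ Finset.range K, (x ^ 2) ^ i = (1 - (x ^ 2) ^ K) / (1 - x ^ 2) := by
    rw [eq_div_iff hx2]; linear_combination -hgeom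
  have hx3 : x - x⁻¹ ≠ 0 := by
    intro h; apply hx2; field_simp at h; linear_combination -h
  have hp : x ^ (2 * K + 1) = x * (x ^ 2) ^ K := by rw [← pow_mul, pow_succ']
  rw [hsum, hp]
  have hx4 : x ^ 2 - 1 ≠ 0 := fun h => hx2 (by linear_combination -h)
  have e : x - x⁻¹ = -(1 - x ^ 2) / x := by field_simp; ring
  rw [e, inv_div]
  field_simp
  ring

/-- The square of 8j + m differs from m² by 16(4j² + jm), so the phase has period four in the index.
-/
theorem exp_odd_sq (j i : ℕ) (w : ℂ)
    (hw : exp (-(Real.pi * I * ((2 * i + 1 : ℕ) : ℂ) ^ 2 / 8)) = exp (-(Real.pi * I / 8)) * w) :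
    exp (-(Real.pi * I * ((2 * (4 * j + i) + 1 : ℕ) : ℂ) ^ 2 / 8)) = exp (-(Real.pi * I / 8)) * w := by
  rw [← hw]
  refine exp_eq_exp_iff_exists_int.2 ⟨-(4 * j ^ 2 + j * (2 * i + 1)), ?_⟩
  push_cast
  ring

/-- The alternating theta-type partial sums in closed form. -/
theorem sum_exp_odd_sq_mul_pow (q : ℂ) (j : ℕ) :
    (∑ k ∈ Finset.range (4 * j), exp (-(Real.pi * I * ((2 * k + 1 : ℕ) : ℂ) ^ 2 / 8)) *
      q ^ (2 * k + 1)) * (1 + q ^ 4) =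
      exp (-(Real.pi * I / 8)) * (q * (1 - q ^ 2) * (1 - q ^ (8 * j))) := by
  -- The signs 1, -1, -1, 1 come from 1, 9, 25, 49 ≡ 1, 9, 9, 1 modulo 16. One block gives q - q³ -
  -- q⁵ + q⁷ = q(1 - q²)(1 - q⁴), whence the factor 1 + q⁴.
  have e0 : exp (-(Real.pi * I * ((2 * 0 + 1 : ℕ) : ℂ) ^ 2 / 8)) = exp (-(Real.pi * I / 8)) * 1 := by
    simp
  have e1 : exp (-(Real.pi * I * ((2 * 1 + 1 : ℕ) : ℂ) ^ 2 / 8)) = exp (-(Real.pi * I / 8)) * -1 := by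
    rw [← exp_pi_mul_I, ← exp_add]
    refine exp_eq_exp_iff_exists_int.2 ⟨-1, ?_⟩; push_cast; ring
  have e2 : exp (-(Real.pi * I * ((2 * 2 + 1 : ℕ) : ℂ) ^ 2 / 8)) = exp (-(Real.pi * I / 8)) * -1 := by
    rw [← exp_pi_mul_I, ← exp_add]
    refine exp_eq_exp_iff_exists_int.2 ⟨-2, ?_⟩; push_cast; ring
  have e3 : exp (-(Real.pi * I * ((2 * 3 + 1 : ℕ) : ℂ) ^ 2 / 8)) = exp (-(Real.pi * I / 8)) * 1 := by
    rw [mul_one]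
    refine exp_eq_exp_iff_exists_int.2 ⟨-3, ?_⟩; push_cast; ring
  induction j with
  | zero => simp
  | succ j ih =>
    have h : 4 * (j + 1) = 4 * j + 1 + 1 + 1 + 1 := by ring
    rw [h, Finset.sum_range_succ, Finset.sum_range_succ, Finset.sum_range_succ,
      Finset.sum_range_succ, add_mul, add_mul, add_mul, add_mul, ih]
    have f0 := exp_odd_sq j 0 _ e0
    have f1 := exp_odd_sq j 1 _ e1
    have f2 := exp_odd_sq j 2 _ e2
    have f3 := exp_odd_sq j 3 _ e3
    simp only [add_assoc] at f0 f1 f2 f3 ⊢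
    rw [add_zero] at f0
    rw [f0, f1, f2, f3]
    have p : q ^ (8 * (j + 1)) = q ^ (8 * j) * q ^ 8 := by rw [← pow_add]; ring
    have p0 : q ^ (2 * (4 * j) + 1) = q ^ (8 * j) * q := by rw [← pow_succ]; ring_nf
    have p1 : q ^ (2 * (4 * j + 1) + 1) = q ^ (8 * j) * q ^ 3 := by rw [← pow_add]; ring_nf
    have p2 : q ^ (2 * (4 * j + 2) + 1) = q ^ (8 * j) * q ^ 5 := by rw [← pow_add]; ring_nf
    have p3 : q ^ (2 * (4 * j + 3) + 1) = q ^ (8 * j) * q ^ 7 := by rw [← pow_add]; ring_nf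
    rw [p, p0, p1, p2, p3]
    ring

theorem norm_one_sub_sq_inv_le {x : ℂ} {y : ℝ} (hy : 0 < y) (hx : ‖x‖ = Real.exp (-y)) :
    ‖(1 - x ^ 2)⁻¹‖ ≤ 1 + 1 / y := by
  have h1 : 1 - Real.exp (-y) ≤ ‖1 - x ^ 2‖ := by
    have h := norm_sub_norm_le (1:ℂ) (x ^ 2)
    rw [norm_one, norm_pow, hx] at h
    have h2 : Real.exp (-y) ≤ 1 := Real.exp_le_one_iff.2 (by linarith)
    nlinarith [Real.exp_pos (-y)]
  have h3 : Real.exp (-y) ≤ (1 + y)⁻¹ := by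
    rw [Real.exp_neg]
    exact inv_anti₀ (by positivity) (by linarith [Real.add_one_le_exp y])
  have h4 : y / (1 + y) ≤ ‖1 - x ^ 2‖ := by
    have : y / (1 + y) = 1 - (1 + y)⁻¹ := by field_simp; ring
    linarith
  rw [norm_inv]
  calc (‖1 - x ^ 2‖)⁻¹ ≤ (y / (1 + y))⁻¹ := inv_anti₀ (by positivity) h4
    _ = 1 + 1 / y := by field_simp; ring

/-- On the ray rη the kernel loses 4πabφ(r), where φ ≥ 0 vanishes at r = 1. Half of this is spent on
gaining e^{-4πbJ}: for r ≥ 1/2 the tail factor alone suffices, and for r ≤ 1/2 one has φ ≥ 0.19 and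
2·11·0.19 > 4, which explains a ≥ 11J. The other half is at least 4φ and provides r⁴ e^{2(1-r²)},
for integrability. -/
theorem tail_exponent_le {a b r J : ℝ} (hb : 0 < b) (ha : 11 * J ≤ a) (ha0 : 2 ≤ Real.pi * (a * b))
    (hJ : 0 ≤ J) (hr : 0 < r) :
    4 * Real.pi * (a * b) * (Real.log r + (1 - r ^ 2) / 2) - Real.pi * b * r * (8 * J + 1) ≤
      -(Real.pi * b * (4 * J)) + (4 * Real.log r + 2 * (1 - r ^ 2)) := by
  have hpi := Real.pi_pos
  set φ := -(Real.log r + (1 - r ^ 2) / 2) with hφ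
  have hφ0 : 0 ≤ φ := by
    have := Real.log_le_sub_one_of_pos (pow_pos hr 2)
    rw [Real.log_pow] at this
    push_cast at this
    linarith
  have key : 4 * J ≤ 2 * a * φ + r * (8 * J + 1) := by
    rcases le_total (1 / 2) r with h | h
    · have : 0 ≤ 2 * a * φ := by have : 0 ≤ a := by linarith
                                 positivity
      nlinarith
    · have h1 : Real.log r ≤ -0.693 := by
        have h2 : Real.log r ≤ Real.log (1 / 2) := Real.log_le_log hr h
        rw [one_div, Real.log_inv] at h2
        linarith [Real.log_two_gt_d9]
      have h2 : 0.19 ≤ φ := by rw [hφ]; nlinarith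
      have h3 : 0 ≤ r * (8 * J + 1) := by positivity
      nlinarith
  have h1 := mul_le_mul_of_nonneg_left key (mul_nonneg hpi.le hb.le)
  have h2 : 4 * φ ≤ 2 * (Real.pi * (a * b)) * φ := by nlinarith
  have h3 : Real.log r + (1 - r ^ 2) / 2 = -φ := by rw [hφ]; ring
  have h4 : 4 * Real.log r + 2 * (1 - r ^ 2) = -(4 * φ) := by rw [hφ]; ring
  rw [h3, h4]
  nlinarith

theorem sq_add_cube_mul_exp_le {r : ℝ} (hr : 0 < r) :
    (r ^ 2 + r ^ 3) * Real.exp (2 * (1 - r ^ 2)) ≤ 25 * Real.exp (-r) := by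
  -- The difference of the exponents is (r - 1/2)².
  have h1 : Real.exp (2 * (1 - r ^ 2)) ≤ Real.exp (9 / 4) * Real.exp (-r ^ 2) * Real.exp (-r) := by
    rw [← Real.exp_add, ← Real.exp_add]
    refine Real.exp_le_exp.2 ?_
    nlinarith [sq_nonneg (r - 1 / 2)]
  have h2 : Real.exp (9 / 4) ≤ 10 := by
    have h3 := Real.exp_one_lt_d9
    have : Real.exp (9 / 4) ^ 4 = Real.exp 1 ^ 9 := by
      rw [← Real.exp_nat_mul, ← Real.exp_nat_mul]; norm_num
    have h4 : Real.exp 1 ^ 9 ≤ 2.72 ^ 9 := by gcongr; linarith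
    by_contra! h5
    have : (10:ℝ) ^ 4 < Real.exp (9 / 4) ^ 4 := by gcongr
    have h6 : (2.72:ℝ) ^ 9 ≤ 10 ^ 4 := by norm_num
    linarith
  have h3 : (r ^ 2 + r ^ 3) * Real.exp (-r ^ 2) ≤ 5 / 2 := by
    have h4 := Real.quadratic_le_exp_of_nonneg (sq_nonneg r)
    rw [Real.exp_neg, ← div_eq_mul_inv, div_le_iff₀ (Real.exp_pos _)]
    nlinarith [sq_nonneg (r ^ 2 - r), sq_nonneg (r ^ 2), sq_nonneg r]
  calc _ ≤ (r ^ 2 + r ^ 3) * (Real.exp (9 / 4) * Real.exp (-r ^ 2) * Real.exp (-r)) := by gcongr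
    _ = Real.exp (9 / 4) * ((r ^ 2 + r ^ 3) * Real.exp (-r ^ 2)) * Real.exp (-r) := by ring
    _ ≤ 10 * (5 / 2) * Real.exp (-r) := by gcongr
    _ = _ := by ring

/-- The tail needs no saddle point analysis. Near r = 0 the factors 1/z and 1/(1 - x²) are each of
order 1/r, which the r⁴ left over by `tail_exponent_le` absorbs. -/
theorem norm_tail_integrand_le {η : ℂ} (h1 : 0 < η.im) (h2 : η.im ≤ η.re)
    (hN : 2 ≤ Real.pi * (η.re * η.im)) {j : ℕ} (hj : 11 * (j : ℝ) ≤ η.re) {r : ℝ} (hr : 0 < r) :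
    ‖kernel (1 + 2 * Real.pi * I * η ^ 2) (r * η) * (exp (Real.pi * I * (r * η)) ^ (2 * (4 * j) + 1) /
      (1 - exp (Real.pi * I * (r * η)) ^ 2)) * η‖ ≤
      25 * ‖exp (expo η 0 η)‖ * Real.exp (-(Real.pi * η.im)) ^ (4 * j) * (1 + 1 / η.im) *
        Real.exp (-r) := by
  have hη0 : η ≠ 0 := by rintro rfl; simp at h1
  have hpi := Real.pi_gt_three
  have hr0 : (r : ℂ) ≠ 0 := ofReal_ne_zero.2 hr.ne'
  have hk : kernel (1 + 2 * Real.pi * I * η ^ 2) (r * η) = exp (expo η 0 (r * η)) / (r * η) := by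
    have := kernel_mul_exp_eq (η := η) 0 (mul_ne_zero hr0 hη0)
    simpa using this
  set x := exp (Real.pi * I * (r * η)) with hx
  have hxn : ‖x‖ = Real.exp (-(Real.pi * r * η.im)) := by
    rw [hx, norm_exp_pi_I_mul, im_ofReal_mul]; congr 1; ring
  have hy : 0 < Real.pi * r * η.im := by positivity
  have hinv := norm_one_sub_sq_inv_le hy hxn
  have he : (expo η 0 (r * η)).re = (expo η 0 η).re +
      4 * Real.pi * (η.re * η.im) * (Real.log r + (1 - r ^ 2) / 2) := by
    have e : expo η 0 (r * η) = expo η 0 η + (((-(2 * Real.pi) * (Real.log r)) : ℝ) : ℂ) * (I * η ^ 2)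
        + ((Real.pi * (r ^ 2 - 1) : ℝ) : ℂ) * (I * η ^ 2) := by
      rw [expo, expo, log_ofReal_mul hr hη0]; push_cast; ring
    rw [e, add_re, add_re, re_ofReal_mul, re_ofReal_mul, I_mul_re, sq, mul_im]; ring
  have e2 : kernel (1 + 2 * Real.pi * I * η ^ 2) (r * η) * (x ^ (2 * (4 * j) + 1) / (1 - x ^ 2)) * η =
      exp (expo η 0 (r * η)) / r * x ^ (2 * (4 * j) + 1) * (1 - x ^ 2)⁻¹ := by
    rw [hk]; field_simp
  rw [e2, norm_mul, norm_mul, norm_pow, norm_div, norm_real, Real.norm_of_nonneg hr.le, norm_exp, he,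
    hxn, norm_exp, ← Real.exp_nat_mul, ← Real.exp_nat_mul]
  have hte := tail_exponent_le h1 hj hN (Nat.cast_nonneg j) hr
  have hsc := sq_add_cube_mul_exp_le hr
  have hlog4 : Real.exp (4 * Real.log r) = r ^ 4 := by
    rw [← Real.exp_log hr, Real.log_exp, ← Real.exp_nat_mul]; norm_num
  calc _ ≤ Real.exp ((expo η 0 η).re + 4 * Real.pi * (η.re * η.im) * (Real.log r + (1 - r ^ 2) / 2)) / r
        * Real.exp (((2 * (4 * j) + 1 : ℕ) : ℝ) * -(Real.pi * r * η.im)) *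
        (1 + 1 / (Real.pi * r * η.im)) := by gcongr
    _ = Real.exp (expo η 0 η).re * Real.exp (4 * Real.pi * (η.re * η.im) *
          (Real.log r + (1 - r ^ 2) / 2) - Real.pi * η.im * r * (8 * j + 1)) *
          (1 / r * (1 + 1 / (Real.pi * r * η.im))) := by
        have : 4 * Real.pi * (η.re * η.im) * (Real.log r + (1 - r ^ 2) / 2) -
          Real.pi * η.im * r * (8 * j + 1) = 4 * Real.pi * (η.re * η.im) *
          (Real.log r + (1 - r ^ 2) / 2) + ((2 * (4 * j) + 1 : ℕ) : ℝ) * -(Real.pi * r * η.im) := by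
          push_cast; ring
        rw [this, Real.exp_add, Real.exp_add]; ring
    _ ≤ Real.exp (expo η 0 η).re * Real.exp (-(Real.pi * η.im * (4 * j)) +
          (4 * Real.log r + 2 * (1 - r ^ 2))) * (1 / r * (1 + 1 / (Real.pi * r * η.im))) := by gcongr
    _ = Real.exp (expo η 0 η).re * Real.exp (-(Real.pi * η.im * (4 * j))) *
          ((r ^ 3 + r ^ 2 / (Real.pi * η.im)) * Real.exp (2 * (1 - r ^ 2))) := by
        rw [Real.exp_add, Real.exp_add, hlog4]; field_simp
    _ ≤ Real.exp (expo η 0 η).re * Real.exp (-(Real.pi * η.im * (4 * j))) *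
          ((1 + 1 / η.im) * ((r ^ 2 + r ^ 3) * Real.exp (2 * (1 - r ^ 2)))) := by
        have h3 : r ^ 3 + r ^ 2 / (Real.pi * η.im) ≤ (1 + 1 / η.im) * (r ^ 2 + r ^ 3) := by
          have h4 : r ^ 2 / (Real.pi * η.im) ≤ r ^ 2 / η.im := by
            gcongr; nlinarith
          have h5 : 0 ≤ 1 / η.im * r ^ 3 := by positivity
          have h6 : r ^ 2 / η.im = 1 / η.im * r ^ 2 := by ring
          nlinarith [sq_nonneg r]
        rw [← mul_assoc (1 + 1 / η.im)]
        gcongr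
    _ ≤ Real.exp (expo η 0 η).re * Real.exp (-(Real.pi * η.im * (4 * j))) *
          ((1 + 1 / η.im) * (25 * Real.exp (-r))) := by gcongr
    _ = _ := by
        have : ((4 * j : ℕ) : ℝ) * -(Real.pi * η.im) = -(Real.pi * η.im * (4 * j)) := by
          push_cast; ring
        rw [this]; ring

/-- The ray integral for `R(s)`, `s = 1 + 2π i η²`, up to explicit errors. -/
theorem norm_ray_integral_add_le {η : ℂ} (h1 : 0 < η.im) (h2 : η.im ≤ η.re) {L : ℝ}
    (hL : 100 ≤ L) (hηL : ‖η‖ = L ^ 5) (hN : 2 ≤ Real.pi * (η.re * η.im)) {j : ℕ}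
    (hj : 8 * (j : ℝ) ≤ L) :
    ‖(∫ r in Ioi (0:ℝ), kernel (1 + 2 * Real.pi * I * η ^ 2) (r * η) * (den (r * η))⁻¹ * η) +
      exp (expo η 0 η) / η * diag / (√2 : ℝ) * (exp (-(Real.pi * I / 8)) *
        (exp (Real.pi * I * η) * (1 - exp (Real.pi * I * η) ^ 2) *
          (1 - exp (Real.pi * I * η) ^ (8 * j)) / (1 + exp (Real.pi * I * η) ^ 4)))‖ ≤
      10001 * (L ^ 2)⁻¹ * ‖exp (expo η 0 η) / η‖ * (Real.exp (-(Real.pi * η.im)) /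
        (1 - Real.exp (-(Real.pi * η.im)) ^ 2)) +
      25 * ‖exp (expo η 0 η)‖ * Real.exp (-(Real.pi * η.im)) ^ (4 * j) * (1 + 1 / η.im) := by
  have hL3 : 100 * L ≤ L ^ 5 := by
    calc 100 * L ≤ L ^ 4 * L := by
          gcongr; exact hL.trans (le_self_pow₀ (by linarith) (by norm_num))
      _ = L ^ 5 := by ring
  have hre : 0 < η.re := h1.trans_le h2
  have hN4 : 2 ≤ 4 * Real.pi * (η.re * η.im) := by nlinarith
  have hjre : 11 * (j : ℝ) ≤ η.re := by
    have hab := norm_le_abs_re_add_abs_im η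
    rw [abs_of_pos h1, abs_of_pos hre, hηL] at hab
    linarith
  set s := 1 + 2 * Real.pi * I * η ^ 2 with hs
  have hsre : s.re ≤ -1 := by rw [hs, re_one_add_two_pi_I_mul]; linarith
  set q := exp (Real.pi * I * η) with hq
  set Q := Real.exp (-(Real.pi * η.im)) with hQ
  have hqQ : ‖q‖ = Q := by rw [hq, hQ, norm_exp_pi_I_mul]
  have hQ0 : 0 < Q := Real.exp_pos _
  have hpi := Real.pi_pos
  have hQ1 : Q < 1 := Real.exp_lt_one_iff.2 (by nlinarith [mul_pos hpi h1])
  set E := exp (expo η 0 η) with hE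
  -- Changing c multiplies the value at η by a power of q; hence the main terms form the closed sum
  -- and the errors a geometric series in Q².
  have hEc : ∀ k : ℕ, exp (expo η ((2 * k + 1 : ℕ) : ℝ) η) = E * q ^ (2 * k + 1) := fun k => by
    rw [hE, hq, ← exp_nat_mul, ← exp_add, expo, expo]; congr 1; push_cast; ring
  have iJ := (integral_upper hsre hre h1).1
  have hT : ∀ k ∈ Finset.range (4 * j), _ := fun k hk =>
    norm_integral_kernel_sub_le h1 h2 hL hηL hN4 (c := ((2 * k + 1 : ℕ) : ℝ)) (Nat.cast_nonneg _)
      (by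
        have : (2 * k + 1 : ℕ) ≤ 8 * j := by have := Finset.mem_range.1 hk; omega
        have : ((2 * k + 1 : ℕ) : ℝ) ≤ ((8 * j : ℕ) : ℝ) := by exact_mod_cast this
        push_cast at this ⊢; linarith) hre h1
  set T : ℕ → ℂ := fun k => ∫ r in Ioi (0:ℝ), kernel s (r * η) *
    exp (Real.pi * I * (((2 * k + 1 : ℕ) : ℝ) * (r * η))) * η with hTdef
  set tl : ℝ → ℂ := fun r => kernel s (r * η) * (exp (Real.pi * I * (r * η)) ^ (2 * (4 * j) + 1) /
      (1 - exp (Real.pi * I * (r * η)) ^ 2)) * η with htl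
  have hpt : ∀ r ∈ Ioi (0:ℝ), tl r = -(kernel s (r * η) * (den (r * η))⁻¹ * η) -
      ∑ k ∈ Finset.range (4 * j), kernel s (r * η) *
        exp (Real.pi * I * (((2 * k + 1 : ℕ) : ℝ) * (r * η))) * η := by
    intro r hr
    have : 0 < ((r : ℂ) * η).im := by rw [im_ofReal_mul]; exact mul_pos hr h1
    have h3 := neg_inv_den_eq this (4 * j)
    rw [← Finset.sum_mul, ← Finset.mul_sum]
    simp only [htl]
    linear_combination -(kernel s (r * η) * η) * h3
  have hJ : (∫ r in Ioi (0:ℝ), tl r) = -(∫ r in Ioi (0:ℝ), kernel s (r * η) * (den (r * η))⁻¹ * η) -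
      ∑ k ∈ Finset.range (4 * j), T k := by
    have hA : IntegrableOn (fun r : ℝ => -(kernel s (r * η) * (den (r * η))⁻¹ * η)) (Ioi 0) :=
      (iJ.mul_const η).neg
    have hB : IntegrableOn (fun r : ℝ => ∑ k ∈ Finset.range (4 * j), kernel s (r * η) *
        exp (Real.pi * I * (((2 * k + 1 : ℕ) : ℝ) * (r * η))) * η) (Ioi 0) :=
      integrable_finsetSum _ fun k hk => (hT k hk).1.mul_const η
    rw [setIntegral_congr_fun measurableSet_Ioi hpt, integral_sub hA hB, integral_neg,
      integral_finsetSum _ fun k hk => (hT k hk).1.mul_const η]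
  have htail : ‖∫ r in Ioi (0:ℝ), tl r‖ ≤ 25 * ‖E‖ * Q ^ (4 * j) * (1 + 1 / η.im) := by
    have hexp : IntegrableOn (fun r : ℝ => Real.exp (-r)) (Ioi 0) := by
      simpa using integrableOn_exp_neg_Ioi 0
    refine (norm_integral_le_of_norm_le (hexp.const_mul (25 * ‖E‖ * Q ^ (4 * j) * (1 + 1 / η.im)))
      ((ae_restrict_iff' measurableSet_Ioi).2 (ae_of_all _ fun r hr =>
        norm_tail_integrand_le h1 h2 hN hjre hr))).trans ?_
    rw [integral_const_mul, integral_exp_neg_Ioi_zero, mul_one]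
  have hq4 : 1 + q ^ 4 ≠ 0 := by
    intro h
    have h2 : ‖q ^ 4‖ = 1 := by
      have : q ^ 4 = -1 := by linear_combination h
      rw [this]; simp
    rw [norm_pow, hqQ] at h2
    have := pow_lt_one₀ hQ0.le hQ1 (n := 4) (by norm_num)
    linarith
  have hclosed : exp (-(Real.pi * I / 8)) * (q * (1 - q ^ 2) * (1 - q ^ (8 * j)) / (1 + q ^ 4)) =
      ∑ k ∈ Finset.range (4 * j), exp (-(Real.pi * I * ((2 * k + 1 : ℕ) : ℂ) ^ 2 / 8)) *
        q ^ (2 * k + 1) := by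
    rw [← mul_div_assoc, div_eq_iff hq4, sum_exp_odd_sq_mul_pow]
  have hdec : (∫ r in Ioi (0:ℝ), kernel s (r * η) * (den (r * η))⁻¹ * η) +
      E / η * diag / (√2 : ℝ) * (exp (-(Real.pi * I / 8)) *
        (q * (1 - q ^ 2) * (1 - q ^ (8 * j)) / (1 + q ^ 4))) =
      -(∑ k ∈ Finset.range (4 * j), (T k - exp (expo η ((2 * k + 1 : ℕ) : ℝ) η) / η * diag *
        (exp (-(Real.pi * I * (((2 * k + 1 : ℕ) : ℝ) : ℂ) ^ 2 / 8)) / (√2 : ℝ)))) -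
        ∫ r in Ioi (0:ℝ), tl r := by
    rw [hclosed, hJ, Finset.sum_sub_distrib, Finset.mul_sum]
    have : ∀ k ∈ Finset.range (4 * j), exp (expo η ((2 * k + 1 : ℕ) : ℝ) η) / η * diag *
        (exp (-(Real.pi * I * (((2 * k + 1 : ℕ) : ℝ) : ℂ) ^ 2 / 8)) / (√2 : ℝ)) =
        E / η * diag / (√2 : ℝ) * (exp (-(Real.pi * I * ((2 * k + 1 : ℕ) : ℂ) ^ 2 / 8)) *
        q ^ (2 * k + 1)) := fun k _ => by rw [hEc, ofReal_natCast]; ring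
    rw [Finset.sum_congr rfl this]
    ring
  rw [hdec]
  refine (norm_sub_le _ _).trans (add_le_add ?_ htail)
  rw [norm_neg]
  refine (norm_sum_le_of_le _ fun k hk => (hT k hk).2).trans ?_
  have : ∀ k ∈ Finset.range (4 * j), 10001 * (L ^ 2)⁻¹ * ‖exp (expo η ((2 * k + 1 : ℕ) : ℝ) η) / η‖ =
      10001 * (L ^ 2)⁻¹ * ‖E / η‖ * (Q * (Q ^ 2) ^ k) := fun k _ => by
    rw [hEc, mul_div_right_comm, norm_mul, norm_pow, hqQ]; ring
  rw [Finset.sum_congr rfl this, ← Finset.mul_sum, ← Finset.mul_sum]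
  have hQ2 : Q ^ 2 < 1 := pow_lt_one₀ hQ0.le hQ1 (by norm_num)
  have hg : ∑ i ∈ Finset.range (4 * j), (Q ^ 2) ^ i ≤ 1 / (1 - Q ^ 2) := by
    rw [le_div_iff₀ (by linarith)]
    have := geom_sum_mul (Q ^ 2) (4 * j)
    have : 0 ≤ (Q ^ 2) ^ (4 * j) := by positivity
    linarith
  calc _ ≤ 10001 * (L ^ 2)⁻¹ * ‖E / η‖ * (Q * (1 / (1 - Q ^ 2))) := by gcongr
    _ = _ := by ring

/-! ### The Gamma function and the factor χ -/

theorem integral_cpow_mul_exp_neg_pi_sq {w : ℂ} (hw : 0 < w.re) :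
    ∫ r in Ioi (0:ℝ), (r : ℂ) ^ (2 * w - 1) * exp (-(Real.pi * r ^ 2)) =
      1 / 2 * ((1 / Real.pi : ℂ) ^ w * Gamma w) := by
  have hc := integral_comp_rpow_Ioi_of_pos (p := 2)
    (g := fun y : ℝ => (y : ℂ) ^ (w - 1) * exp (-(Real.pi * y))) two_pos
  rw [← integral_cpow_mul_exp_neg_mul_Ioi hw Real.pi_pos, ← hc, ← integral_const_mul]
  refine setIntegral_congr_fun measurableSet_Ioi fun r hr => ?_
  have hr0 : (0:ℝ) < r := hr
  have hrc : (r : ℂ) ≠ 0 := ofReal_ne_zero.2 hr0.ne'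
  have e1 : ((r ^ (2:ℝ) : ℝ) : ℂ) ^ (w - 1) = (r : ℂ) ^ (2 * (w - 1)) := by
    rw [cpow_def_of_ne_zero (ofReal_ne_zero.2 (Real.rpow_pos_of_pos hr0 _).ne'),
      cpow_def_of_ne_zero hrc, ← ofReal_log (Real.rpow_pos_of_pos hr0 _).le, Real.log_rpow hr0,
      ← ofReal_log hr0.le]
    congr 1; push_cast; ring
  have e2 : (r : ℂ) ^ (2 * w - 1) = r * (r : ℂ) ^ (2 * (w - 1)) := by
    have : 2 * w - 1 = 1 + 2 * (w - 1) := by ring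
    rw [this, cpow_add _ _ hrc, cpow_one]
  have e3 : ((r ^ (2:ℝ) : ℝ) : ℂ) = (r : ℂ) ^ 2 := by
    rw [Real.rpow_two]; push_cast; rfl
  simp only [real_smul]
  rw [e1, e2, e3]
  norm_num
  ring

/-- On the diagonal z² = ir², so e^{πiz²} is the real Gaussian e^{-πr²} and the ray integral with c
= 0 is a Gamma integral. -/
theorem kernel_diag_mul_diag (s : ℂ) {r : ℝ} (hr : 0 < r) :
    kernel s (r * diag) * diag =
      exp ((1 - s) * (Real.pi * I / 4)) * ((r : ℂ) ^ (-s) * exp (-(Real.pi * r ^ 2))) := by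
  have hrc : (r : ℂ) ≠ 0 := ofReal_ne_zero.2 hr.ne'
  have hlog : log diag = Real.pi * I / 4 := by
    rw [diag, log_exp]
    · simp; linarith [Real.pi_pos]
    · simp; linarith [Real.pi_pos]
  rw [kernel, cpow_def_of_ne_zero (mul_ne_zero hrc diag_ne_zero), cpow_def_of_ne_zero hrc,
    log_ofReal_mul hr diag_ne_zero, hlog, mul_pow, diag_sq, ofReal_log hr.le]
  nth_rewrite 1 [diag]
  simp only [← exp_add]
  congr 1
  linear_combination (Real.pi * r ^ 2 : ℂ) * I_sq

/-- Stirling's approximation of `Γ(-2π i η²)`. -/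
theorem norm_Gamma_sub_le {η : ℂ} (h1 : 0 < η.im) (h2 : η.im ≤ η.re) {L : ℝ}
    (hL : 100 ≤ L) (hηL : ‖η‖ = L ^ 5) (hN : 2 ≤ Real.pi * (η.re * η.im)) {l : ℂ}
    (hl : l = -(2 * Real.pi * I * η ^ 2)) :
    ‖exp (l * (Real.pi * I / 2)) * (1 / 2 * ((1 / Real.pi : ℂ) ^ l * Gamma l)) -
      exp (l * (Real.log 2 : ℝ)) * exp (expo η 0 η) ^ 2 * (diag / (2 * η))‖ ≤
      20002 * (L ^ 2)⁻¹ * ‖exp (l * (Real.log 2 : ℝ)) * exp (expo η 0 η) ^ 2 * (diag / (2 * η))‖ := by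
  set κ : ℝ := √2 with hκ
  have hκ0 : 0 < κ := by positivity
  have hκ2 : κ ^ 2 = 2 := Real.sq_sqrt (by norm_num)
  have hκ1 : 1 ≤ κ := Real.one_le_sqrt.2 (by norm_num)
  -- The scaling by √2 makes 1 + 2πiξ² equal to 1 - 2l, so that the kernel becomes r^{2l-1}
  -- e^{-πr²}, whose integral is a multiple of Γ(l).
  set ξ : ℂ := κ * η with hξ
  set L' : ℝ := ‖ξ‖ ^ (1 / 5 : ℝ) with hL'
  have hη0 : η ≠ 0 := by rintro rfl; simp at h1
  have hξn : ‖ξ‖ = κ * ‖η‖ := by rw [hξ, norm_mul, norm_real, Real.norm_of_nonneg hκ0.le]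
  have hL'5 : ‖ξ‖ = L' ^ 5 := by
    rw [hL', ← Real.rpow_natCast, ← Real.rpow_mul (norm_nonneg _)]; norm_num
  have hLL' : L ≤ L' := by
    have : L ^ 5 ≤ L' ^ 5 := by
      rw [← hL'5, hξn, hηL]
      nlinarith [pow_pos (show 0 < L by linarith) 5]
    exact le_of_pow_le_pow_left₀ (by norm_num) (Real.rpow_nonneg (norm_nonneg _) _) this
  have hκre : ξ.re = κ * η.re := by rw [hξ, re_ofReal_mul]
  have hκim : ξ.im = κ * η.im := by rw [hξ, im_ofReal_mul]
  have hre : 0 < η.re := h1.trans_le h2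
  have hκc : (κ : ℂ) ^ 2 = 2 := by rw [← ofReal_pow, hκ2]; simp
  have hl2 : 1 + 2 * Real.pi * I * ξ ^ 2 = 1 - 2 * l := by
    rw [hξ, hl, mul_pow, hκc]; ring
  have hT := (norm_integral_kernel_sub_le (η := ξ) (L := L') (c := 0) (e := diag)
    (by rw [hκim]; positivity) (by rw [hκim, hκre]; gcongr) (hL.trans hLL') hL'5
    (by
      rw [hκre, hκim]
      have : 4 * Real.pi * (κ * η.re * (κ * η.im)) = 8 * (Real.pi * (η.re * η.im)) := by
        linear_combination (4 * Real.pi * η.re * η.im) * hκ2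
      rw [this]; linarith)
    le_rfl (by linarith) (by rw [diag_re]; positivity) (by rw [diag_im]; positivity)).2
  rw [hl2] at hT
  have hlre : 0 < l.re := by
    have e : l = ((-(2 * Real.pi) : ℝ) : ℂ) * (I * η ^ 2) := by rw [hl]; push_cast; ring
    rw [e, re_ofReal_mul, I_mul_re, sq, mul_im]
    nlinarith
  have hint : ∫ r in Ioi (0:ℝ), kernel (1 - 2 * l) (r * diag) *
      exp (Real.pi * I * ((0:ℝ) * (r * diag))) * diag =
      exp (l * (Real.pi * I / 2)) * (1 / 2 * ((1 / Real.pi : ℂ) ^ l * Gamma l)) := by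
    rw [← integral_cpow_mul_exp_neg_pi_sq hlre, ← integral_const_mul]
    refine setIntegral_congr_fun measurableSet_Ioi fun r hr => ?_
    have := kernel_diag_mul_diag (1 - 2 * l) (mem_Ioi.1 hr)
    simp only [ofReal_zero, zero_mul, mul_zero, exp_zero, mul_one]
    rw [this]
    congr 2
    · ring
    · congr 2; ring
  -- As ξ² = 2η², the exponent doubles, apart from the term l log 2 due to log √2.
  have hE : exp (expo ξ 0 ξ) = exp (l * (Real.log 2 : ℝ)) * exp (expo η 0 η) ^ 2 := by
    have hlog : log ξ = (Real.log 2 / 2 : ℝ) + log η := by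
      rw [hξ, log_ofReal_mul hκ0 hη0, hκ, Real.log_sqrt (by norm_num)]
    rw [← exp_nat_mul, ← exp_add, expo, expo, hlog, hξ, hl, mul_pow, hκc]
    congr 1; push_cast; ring
  rw [hint, hE] at hT
  have e1 : ∀ X : ℂ, X / ξ * diag * (exp (-(Real.pi * I * ((0:ℝ):ℂ) ^ 2 / 8)) / (κ : ℂ)) =
      X * (diag / (2 * η)) := fun X => by
    have : (κ : ℂ) ≠ 0 := ofReal_ne_zero.2 hκ0.ne'
    rw [hξ, ← hκc]; simp; field_simp
  rw [e1] at hT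
  refine hT.trans ?_
  generalize exp (l * (Real.log 2 : ℝ)) * exp (expo η 0 η) ^ 2 = X
  rw [norm_div, hξn, norm_mul X, norm_div, norm_diag, norm_mul 2]
  have hn0 : 0 < ‖η‖ := norm_pos_iff.2 hη0
  have h3 : (L' ^ 2)⁻¹ ≤ (L ^ 2)⁻¹ := by
    have : 0 < L := by linarith
    gcongr
  have h4 : ‖X‖ / (κ * ‖η‖) ≤ 2 * (‖X‖ * (1 / (‖(2:ℂ)‖ * ‖η‖))) := by
    have : 2 * (‖X‖ * (1 / (‖(2:ℂ)‖ * ‖η‖))) = ‖X‖ / (1 * ‖η‖) := by simp; field_simp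
    rw [this]; gcongr
  calc _ ≤ 10001 * (L ^ 2)⁻¹ * (2 * (‖X‖ * (1 / (‖(2:ℂ)‖ * ‖η‖)))) := by gcongr
    _ = _ := by ring

/-- The functional equation factor in terms of `Γ(1-s)`, with the same factor `1 - e^{π i s}`
that occurs in `R_eq_ray`. -/
theorem chi_eq {s l : ℂ} (hl : l = 1 - s) (hlre : 0 < l.re) :
    chi s = 2 * (exp (l * (Real.pi * I / 2)) * (1 / 2 * ((1 / Real.pi : ℂ) ^ l * Gamma l))) *
      exp (-(l * (Real.log 2 : ℝ))) * (1 - exp (Real.pi * I * s)) := by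
  have hs : s = 1 - l := by rw [hl]; ring
  have hpi : (Real.pi : ℂ) ≠ 0 := ofReal_ne_zero.2 Real.pi_ne_zero
  have hleg := Gamma_mul_Gamma_add_half (l / 2)
  have hrefl := Gamma_mul_Gamma_one_sub (s / 2)
  have e1 : 1 - s / 2 = l / 2 + 1 / 2 := by rw [hl]; ring
  have e2 : sin (Real.pi * (s / 2)) = cos (Real.pi * (l / 2)) := by
    rw [← cos_pi_div_two_sub, hl]; congr 1; ring
  rw [e1, e2] at hrefl
  have hG : Gamma (l / 2 + 1 / 2) ≠ 0 := Gamma_ne_zero_of_re_pos (by simp; positivity)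
  have hinv : (Gamma (s / 2))⁻¹ = Gamma (l / 2 + 1 / 2) * cos (Real.pi * (l / 2)) / Real.pi := by
    by_cases hc : cos (Real.pi * (l / 2)) = 0
    · rw [hc, div_zero] at hrefl
      have := (mul_eq_zero.1 hrefl).resolve_right hG
      rw [hc, this]; simp
    · have : Gamma (s / 2) = Real.pi / cos (Real.pi * (l / 2)) / Gamma (l / 2 + 1 / 2) := by
        rw [← hrefl, mul_div_assoc, div_self hG, mul_one]
      rw [this, inv_div, div_div_eq_mul_div]
  have hcos : cos (Real.pi * (l / 2)) = 1 / 2 * exp (l * (Real.pi * I / 2)) *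
      (1 - exp (Real.pi * I * s)) := by
    have : exp (l * (Real.pi * I / 2)) * exp (Real.pi * I * s) =
        -exp (-(Real.pi * (l / 2)) * I) := by
      rw [neg_eq_neg_one_mul, ← exp_pi_mul_I, ← exp_add, ← exp_add, hs]; congr 1; ring
    have h2 : l * (Real.pi * I / 2) = Real.pi * (l / 2) * I := by ring
    rw [cos, mul_sub, mul_one, mul_assoc (1 / 2 : ℂ), this, h2]; ring
  have hpow2 : (2 : ℂ) ^ (1 - 2 * (l / 2)) = 2 * exp (-(l * (Real.log 2 : ℝ))) := by
    rw [cpow_def_of_ne_zero two_ne_zero, ofReal_log (by norm_num), ofReal_ofNat]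
    calc _ = exp (log 2) * exp (-(l * log 2)) := by rw [← exp_add]; congr 1; ring
      _ = _ := by rw [exp_log two_ne_zero]
  have hlogpi : log (1 / Real.pi : ℂ) = -(Real.log Real.pi : ℝ) := by
    rw [one_div, ← ofReal_inv, ← ofReal_log (by positivity), Real.log_inv]; simp
  have hpow : (Real.pi : ℂ) ^ (s - 1 / 2) * (√Real.pi : ℝ) = Real.pi * (1 / Real.pi : ℂ) ^ l := by
    have hsq : ((√Real.pi : ℝ) : ℂ) = exp ((Real.log Real.pi / 2 : ℝ)) := by
      rw [← ofReal_exp, ← Real.log_sqrt Real.pi_pos.le, Real.exp_log (by positivity)]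
    have hp : (Real.pi : ℂ) = exp ((Real.log Real.pi : ℝ)) := by
      rw [← ofReal_exp, Real.exp_log Real.pi_pos]
    rw [hsq, cpow_def_of_ne_zero hpi, cpow_def_of_ne_zero (by simp),
      hlogpi, ← ofReal_log Real.pi_pos.le]
    calc _ = exp (Real.log Real.pi : ℝ) * exp (-(Real.log Real.pi : ℝ) * l) := by
          rw [← exp_add, ← exp_add, hs]; congr 1; push_cast; ring
      _ = _ := by rw [← hp]
  have hl2 : (1 - s) / 2 = l / 2 := by rw [hl]
  have e3 : 2 * (l / 2) = l := by ring
  rw [hpow2, e3] at hleg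
  rw [chi, hl2, div_eq_mul_inv, hinv]
  calc _ = (Real.pi : ℂ) ^ (s - 1 / 2) * (Gamma (l / 2) * Gamma (l / 2 + 1 / 2)) *
        cos (Real.pi * (l / 2)) / Real.pi := by ring
    _ = ((Real.pi : ℂ) ^ (s - 1 / 2) * (√Real.pi : ℝ)) * Gamma l *
        (2 * exp (-(l * (Real.log 2 : ℝ)))) * cos (Real.pi * (l / 2)) / Real.pi := by rw [hleg]; ring
    _ = _ := by rw [hpow, hcos]; field_simp

/-! ### The main term in terms of η -/

/-- Re η² = t/(2π) and Im η² = (1 - σ)/(2π) are positive, so the principal root has argument between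
0 and π/4. -/
theorem eta_facts {s : ℂ} (hσ : s.re < 1) (ht : 0 < s.im) :
    0 < (eta s).im ∧ (eta s).im ≤ (eta s).re ∧ s = 1 + 2 * Real.pi * I * eta s ^ 2 := by
  have hpi := Real.pi_pos
  set ζ := (s - 1) / (2 * Real.pi * I) with hζ
  have h2pi : (2 * Real.pi * I : ℂ) ≠ 0 := two_pi_I_ne_zero
  have hζs : s = 1 + 2 * Real.pi * I * ζ := by rw [hζ]; field_simp; ring
  have e : 2 * Real.pi * I * ζ = ((2 * Real.pi : ℝ) : ℂ) * (I * ζ) := by push_cast; ring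
  have hre : s.re = 1 - 2 * Real.pi * ζ.im := by
    conv_lhs => rw [hζs, e, add_re, re_ofReal_mul, I_mul_re, one_re]
    ring
  have him : s.im = 2 * Real.pi * ζ.re := by
    conv_lhs => rw [hζs, e, add_im, im_ofReal_mul, I_mul_im, one_im]
    ring
  have hζre : 0 < ζ.re := by
    by_contra! h
    nlinarith
  have hζim : 0 < ζ.im := by
    by_contra! h
    nlinarith
  have hζ0 : ζ ≠ 0 := by intro h; rw [h] at hζre; simp at hζre
  have hη : eta s = ζ ^ (1 / 2 : ℂ) := rfl
  have hsq : eta s ^ 2 = ζ := by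
    rw [hη, ← cpow_nat_mul]; norm_num
  have hηre : 0 < (eta s).re := by
    rw [hη, cpow_def_of_ne_zero hζ0, exp_re]
    refine mul_pos (Real.exp_pos _) (Real.cos_pos_of_mem_Ioo ?_)
    have h1 := neg_pi_lt_arg ζ
    have h2 := arg_le_pi ζ
    have h3 : (log ζ * (1 / 2)).im = arg ζ / 2 := by
      have : log ζ * (1 / 2) = ((1 / 2 : ℝ) : ℂ) * log ζ := by push_cast; ring
      rw [this, im_ofReal_mul, log_im]; ring
    rw [h3]
    have h4 : arg ζ < Real.pi := (abs_arg_lt_pi_div_two_iff.2 (Or.inl hζre) |> abs_lt.1).2.trans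
      (by linarith)
    constructor <;> linarith
  have hr2 : ζ.re = (eta s).re ^ 2 - (eta s).im ^ 2 := by rw [← hsq, sq, mul_re]; ring
  have hi2 : ζ.im = 2 * ((eta s).re * (eta s).im) := by rw [← hsq, sq, mul_im]; ring
  have hηim : 0 < (eta s).im := by
    by_contra! h
    nlinarith [mul_nonneg hηre.le (neg_nonneg.2 h)]
  refine ⟨hηim, ?_, ?_⟩
  · by_contra! h
    nlinarith
  · rw [hsq]; exact hζs

/-- In terms of q = e^{πiη}, the trigonometric factor is minus the limit of the sums of
`sum_exp_odd_sq_mul_pow` divided by √2. The constants agree because i e^{3πi/8} = -e^{-πi/8}. -/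
theorem sin_div_cos_eq {η : ℂ} (hη : 0 < η.im) :
    (√2 : ℝ) * exp (3 * Real.pi * I / 8) * sin (Real.pi * η) / (2 * cos (2 * Real.pi * η)) =
      -(exp (-(Real.pi * I / 8)) / (√2 : ℝ) * (exp (Real.pi * I * η) *
        (1 - exp (Real.pi * I * η) ^ 2) / (1 + exp (Real.pi * I * η) ^ 4))) := by
  set q := exp (Real.pi * I * η) with hq
  have hq0 : q ≠ 0 := exp_ne_zero _
  have hqn : ‖q‖ < 1 := by
    rw [hq, norm_exp_pi_I_mul]
    exact Real.exp_lt_one_iff.2 (by nlinarith [mul_pos Real.pi_pos hη])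
  have hq4 : 1 + q ^ 4 ≠ 0 := by
    intro h
    have h2 : ‖q ^ 4‖ = 1 := by
      have : q ^ 4 = -1 := by linear_combination h
      rw [this]; simp
    rw [norm_pow] at h2
    have := pow_lt_one₀ (norm_nonneg q) hqn (n := 4) (by norm_num)
    linarith
  have hsin : sin (Real.pi * η) = (q⁻¹ - q) * I / 2 := by
    rw [sin, hq, ← exp_neg]; congr 4 <;> ring
  have hcos : 2 * cos (2 * Real.pi * η) = q ^ 2 + (q ^ 2)⁻¹ := by
    rw [cos, hq, ← exp_nat_mul, ← exp_neg, mul_div_cancel₀ _ two_ne_zero]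
    congr 2 <;> push_cast <;> ring
  have h8 : I * exp (3 * Real.pi * I / 8) = -exp (-(Real.pi * I / 8)) := by
    rw [neg_eq_neg_one_mul, ← exp_pi_mul_I]
    nth_rewrite 1 [← exp_pi_div_two_mul_I]
    rw [← exp_add, ← exp_add]; congr 1; ring
  have hsq2 : ((√2 : ℝ) : ℂ) ^ 2 = 2 := by
    rw [← ofReal_pow, Real.sq_sqrt (by norm_num)]; simp
  have hs0 : ((√2 : ℝ) : ℂ) ≠ 0 := by
    intro h; rw [h] at hsq2; norm_num at hsq2
  have hden : q ^ 2 + (q ^ 2)⁻¹ = (1 + q ^ 4) / q ^ 2 := by field_simp; ring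
  rw [hsin, hcos, hden]
  have e1 : exp (-(Real.pi * I / 8)) = -(I * exp (3 * Real.pi * I / 8)) := by rw [h8, neg_neg]
  rw [e1]
  generalize exp (3 * Real.pi * I / 8) = w
  generalize ((√2 : ℝ) : ℂ) = κ at hsq2 hs0 ⊢
  field_simp
  linear_combination w * (1 - q ^ 2) * hsq2

theorem mainTerm_eq {s : ℂ} (hσ : s.re < 1) (ht : 0 < s.im) {l : ℂ} (hl : l = 1 - s) :
    mainTerm s = -(2 * (exp (l * (Real.pi * I / 2)) * (1 / 2 * ((1 / Real.pi : ℂ) ^ l * Gamma l))) *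
      exp (-(l * (Real.log 2 : ℝ))) * (1 - exp (Real.pi * I * s))) * (exp (expo (eta s) 0 (eta s)))⁻¹ *
      ((√2 : ℝ) * exp (3 * Real.pi * I / 8) * sin (Real.pi * eta s) /
        (2 * cos (2 * Real.pi * eta s))) := by
  obtain ⟨h1, -, h3⟩ := eta_facts hσ ht
  have hη0 : eta s ≠ 0 := by intro h; rw [h] at h1; simp at h1
  have hE : eta s ^ (s - 1) * exp (-(Real.pi * I * eta s ^ 2)) = (exp (expo (eta s) 0 (eta s)))⁻¹ := by
    have h4 : s - 1 = 2 * Real.pi * I * eta s ^ 2 := by linear_combination h3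
    rw [cpow_def_of_ne_zero hη0, ← exp_neg, ← exp_add, h4, expo]
    congr 1; push_cast; ring
  rw [mainTerm, ← hE, ← chi_eq hl (by rw [hl]; simp; linarith)]
  ring

/-- Combination of the asymptotics of the ray integral and of the Gamma factor. -/
theorem exists_rel_error {s : ℂ} (hσ : s.re < 1) (ht : 0 < s.im) {L : ℝ} (hL : 1000 ≤ L)
    (hηL : ‖eta s‖ = L ^ 5) (hN : 2 ≤ Real.pi * ((eta s).re * (eta s).im)) {j : ℕ}
    (hj : 8 * (j : ℝ) ≤ L) {Q : ℝ} (hQ : Q = Real.exp (-(Real.pi * (eta s).im))) :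
    ∃ U : ℂ, R s = mainTerm s * (1 + U) ∧
      ‖U‖ ≤ 2 * (3 * (10001 * (L ^ 2)⁻¹ * (1 / (1 - Q ^ 2) ^ 2) +
        25 * L ^ 5 * (Q ^ (4 * j) / Q) * (1 + 1 / (eta s).im) * (1 / (1 - Q ^ 2))) +
        Q ^ (8 * j) + 20002 * (L ^ 2)⁻¹) := by
  obtain ⟨h1, h2, h3⟩ := eta_facts hσ ht
  set η := eta s with hη
  have hpi := Real.pi_pos
  have hη0 : η ≠ 0 := by intro h; rw [h] at h1; simp at h1
  have hn0 : 0 < ‖η‖ := norm_pos_iff.2 hη0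
  have hl : (1 - s) = -(2 * Real.pi * I * η ^ 2) := by linear_combination -h3
  have hJ := norm_ray_integral_add_le h1 h2 (by linarith) hηL hN hj
  have hG := norm_Gamma_sub_le h1 h2 (by linarith) hηL hN hl
  have hM := mainTerm_eq hσ ht rfl
  have hsre : s.re ≤ -1 := by rw [h3, re_one_add_two_pi_I_mul]; linarith
  have hR := R_eq_ray hsre h1 h2
  rw [← h3] at hJ
  rw [← hη] at hM
  have hS := sin_div_cos_eq h1
  set J := ∫ r in Ioi (0 : ℝ), kernel s (r * η) * (den (r * η))⁻¹ * η
  set E := exp (expo η 0 η) with hE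
  have hE0 : E ≠ 0 := exp_ne_zero _
  set S := (√2 : ℝ) * exp (3 * Real.pi * I / 8) * sin (Real.pi * η) / (2 * cos (2 * Real.pi * η))
  set A := exp ((1 - s) * (Real.pi * I / 2)) * (1 / 2 * ((1 / Real.pi : ℂ) ^ (1 - s) * Gamma (1 - s)))
  set q := exp (Real.pi * I * η) with hq
  have hqQ : ‖q‖ = Q := by rw [hq, hQ, norm_exp_pi_I_mul]
  have hQ0 : 0 < Q := by rw [hQ]; exact Real.exp_pos _
  have hQ1 : Q < 1 := by rw [hQ]; exact Real.exp_lt_one_iff.2 (by nlinarith [mul_pos hpi h1])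
  have hQ2 : 0 < 1 - Q ^ 2 := by nlinarith
  rw [← hQ] at hJ
  -- lower bound for the trigonometric factor
  have hSn : Q * (1 - Q ^ 2) / 3 ≤ ‖S‖ := by
    have e8 : ‖exp (-(Real.pi * I / 8))‖ = 1 := by rw [norm_exp]; simp
    rw [hS, norm_neg, norm_mul, norm_div, norm_div, norm_mul, e8, hqQ, norm_real,
      Real.norm_of_nonneg (by positivity)]
    have a1 : 1 - Q ^ 2 ≤ ‖1 - q ^ 2‖ := by
      have h := norm_sub_norm_le (1:ℂ) (q ^ 2)
      rwa [norm_one, norm_pow, hqQ] at h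
    have a2 : ‖1 + q ^ 4‖ ≤ 2 := by
      refine (norm_add_le _ _).trans ?_
      rw [norm_one, norm_pow, hqQ]
      linarith [pow_le_one₀ hQ0.le hQ1.le (n := 4)]
    have a3 : 0 < ‖1 + q ^ 4‖ := by
      have h := norm_sub_norm_le (1:ℂ) (-q ^ 4)
      rw [norm_one, norm_neg, norm_pow, hqQ, sub_neg_eq_add] at h
      linarith [pow_lt_one₀ hQ0.le hQ1 (n := 4) (by norm_num)]
    have a4 : √2 ≤ 1.5 := by rw [Real.sqrt_le_left (by norm_num)]; norm_num
    calc Q * (1 - Q ^ 2) / 3 = 1 / 1.5 * (Q * (1 - Q ^ 2) / 2) := by ring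
      _ ≤ _ := by gcongr
  have hSpos : 0 < ‖S‖ := lt_of_lt_of_le (by positivity) hSn
  have hS0 : S ≠ 0 := norm_pos_iff.1 hSpos
  -- the Gamma factor
  set Y := exp ((1 - s) * (Real.log 2 : ℝ)) * E ^ 2 * (diag / (2 * η)) with hY
  have hY0 : Y ≠ 0 := by
    refine mul_ne_zero (mul_ne_zero (exp_ne_zero _) (pow_ne_zero _ hE0)) (div_ne_zero diag_ne_zero ?_)
    exact mul_ne_zero two_ne_zero hη0
  set ε := (A - Y) / Y with hε
  have hεn : ‖ε‖ ≤ 20002 * (L ^ 2)⁻¹ := by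
    rw [hε, norm_div, div_le_iff₀ (norm_pos_iff.2 hY0)]; exact hG
  have hA : A = Y * (1 + ε) := by rw [hε]; field_simp; ring
  have hL2 : (L ^ 2)⁻¹ ≤ 1 / 1000000 := by
    rw [inv_le_comm₀ (by positivity) (by norm_num)]; nlinarith
  have hε1 : 1 / 2 ≤ ‖1 + ε‖ := by
    have h := norm_sub_norm_le (1:ℂ) (-ε)
    rw [norm_one, norm_neg, sub_neg_eq_add] at h
    linarith
  have hε0 : 1 + ε ≠ 0 := norm_pos_iff.1 (by linarith)
  set D := E / η * diag with hD
  have hD0 : D ≠ 0 := mul_ne_zero (div_ne_zero hE0 hη0) diag_ne_zero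
  have hDn : ‖D‖ = ‖E‖ / L ^ 5 := by rw [hD, norm_mul, norm_div, norm_diag, hηL, mul_one]
  have hM' : mainTerm s = -((1 - exp (Real.pi * I * s)) * (D * (1 + ε) * S)) := by
    have hexp : exp (-((1 - s) * (Real.log 2 : ℝ))) * exp ((1 - s) * (Real.log 2 : ℝ)) = 1 := by
      rw [← exp_add]; simp
    rw [hM, hA, hY, hD]
    have : ∀ u v w : ℂ, v * u = 1 → -(2 * (u * E ^ 2 * (diag / (2 * η)) * (1 + ε)) * v * w) * E⁻¹ * S =
        -(w * (E / η * diag * (1 + ε) * S)) := fun u v w huv => by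
      calc _ = -((v * u) * (w * (E / η * diag * (1 + ε) * S))) := by field_simp
        _ = _ := by rw [huv, one_mul]
    exact this _ _ _ hexp
  have hJ' : ‖J - D * S * (1 - q ^ (8 * j))‖ ≤ 10001 * (L ^ 2)⁻¹ * ‖E / η‖ * (Q / (1 - Q ^ 2)) +
      25 * ‖E‖ * Q ^ (4 * j) * (1 + 1 / η.im) := by
    convert hJ using 2
    rw [hS, hD]; ring
  -- The factor 1 - e^{πis} is common to R(s) and the main term, so it does not enter U and needs no
  -- estimate.
  refine ⟨J / (D * S * (1 + ε)) - 1, ?_, ?_⟩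
  · rw [hR, hM']; field_simp; ring
  have hU : J / (D * S * (1 + ε)) - 1 =
      ((J - D * S * (1 - q ^ (8 * j))) / (D * S) - q ^ (8 * j) - ε) / (1 + ε) := by
    field_simp; ring
  rw [hU, norm_div, div_le_iff₀ (by linarith)]
  have hE0' : 0 < ‖E‖ := norm_pos_iff.2 hE0
  have hnum : ‖(J - D * S * (1 - q ^ (8 * j))) / (D * S) - q ^ (8 * j) - ε‖ ≤
      3 * (10001 * (L ^ 2)⁻¹ * (1 / (1 - Q ^ 2) ^ 2) +
        25 * L ^ 5 * (Q ^ (4 * j) / Q) * (1 + 1 / η.im) * (1 / (1 - Q ^ 2))) +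
        Q ^ (8 * j) + 20002 * (L ^ 2)⁻¹ := by
    refine (norm_sub_le _ _).trans (add_le_add ((norm_sub_le _ _).trans (add_le_add ?_ ?_)) hεn)
    · rw [norm_div, norm_mul D, hDn]
      calc _ ≤ (10001 * (L ^ 2)⁻¹ * ‖E / η‖ * (Q / (1 - Q ^ 2)) +
            25 * ‖E‖ * Q ^ (4 * j) * (1 + 1 / η.im)) / (‖E‖ / L ^ 5 * (Q * (1 - Q ^ 2) / 3)) := by
            gcongr
        _ = _ := by
            rw [norm_div, hηL]; field_simp
    · rw [norm_pow, hqQ]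
  refine hnum.trans ?_
  have hpos : 0 ≤ 3 * (10001 * (L ^ 2)⁻¹ * (1 / (1 - Q ^ 2) ^ 2) +
        25 * L ^ 5 * (Q ^ (4 * j) / Q) * (1 + 1 / η.im) * (1 / (1 - Q ^ 2))) +
        Q ^ (8 * j) + 20002 * (L ^ 2)⁻¹ := by positivity
  nlinarith

/-! ### Choice of parameters and the region Ω -/

/-- The power 50 pays for L^5 = M^35 and two factors M^5 in the tail term, and still leaves M^{-5}.
-/
theorem exp_neg_sq_mul_pow_le (M : ℝ) :
    Real.exp (-(M ^ 2 / 18)) * M ^ 50 ≤ (Nat.factorial 25 : ℝ) * 18 ^ 25 := by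
  have h := Real.pow_div_factorial_le_exp (M ^ 2 / 18) (by positivity) 25
  rw [div_le_iff₀ (by positivity), div_pow, div_le_iff₀ (by positivity), ← pow_mul] at h
  rw [Real.exp_neg, inv_mul_le_iff₀ (Real.exp_pos _)]
  calc M ^ 50 = M ^ (2 * 25) := by norm_num
    _ ≤ _ := h
    _ = _ := by ring

theorem inv_one_sub_exp_sq_le {b M Q : ℝ} (hM : 1 ≤ M) (hb0 : 0 < b) (hb : 1 ≤ 13 * b * M ^ 5)
    (hQ : Q = Real.exp (-(Real.pi * b))) :
    0 < 1 - Q ^ 2 ∧ 1 / (1 - Q ^ 2) ≤ 4 * M ^ 5 := by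
  have hpi := Real.pi_gt_three
  have hy : 6 * b ≤ 2 * (Real.pi * b) := by nlinarith
  have hQ2 : Q ^ 2 = Real.exp (-(2 * (Real.pi * b))) := by
    rw [hQ, ← Real.exp_nat_mul]; congr 1; push_cast; ring
  have h1 : Q ^ 2 ≤ (1 + 6 * b)⁻¹ := by
    rw [hQ2, Real.exp_neg]
    apply inv_anti₀ (by positivity)
    linarith [Real.add_one_le_exp (2 * (Real.pi * b))]
  have h2 : (1 + 6 * b)⁻¹ = 1 - 6 * b / (1 + 6 * b) := by field_simp; ring
  have h3 : 0 < 6 * b / (1 + 6 * b) := by positivity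
  have h4 : 6 * b / (1 + 6 * b) ≤ 1 - Q ^ 2 := by linarith
  refine ⟨by linarith, ?_⟩
  have hM5 : 1 ≤ M ^ 5 := one_le_pow₀ hM
  calc 1 / (1 - Q ^ 2) ≤ 1 / (6 * b / (1 + 6 * b)) := one_div_le_one_div_of_le h3 h4
    _ = (1 + 6 * b) / (6 * b) := by rw [one_div_div]
    _ ≤ 4 * M ^ 5 := by
      rw [div_le_iff₀ (by positivity)]
      nlinarith

/-- With L = M^7 and b ≥ 1/(13 M^5), one has bL ≥ M²/13, so the powers of Q are at most e^{-M²/18}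
and beat every power of M. The dominant term is L^{-2}(1 - Q²)^{-2} = O(M^{-14} M^{10}). -/
theorem rel_error_le {b M L Q : ℝ} {j : ℕ} (hM : 1 ≤ M) (hLM : L = M ^ 7) (hL : 1000 ≤ L)
    (hb0 : 0 < b) (hb : 1 ≤ 13 * b * M ^ 5) (hj : L - 8 ≤ 8 * (j : ℝ))
    (hQ : Q = Real.exp (-(Real.pi * b))) :
    2 * (3 * (10001 * (L ^ 2)⁻¹ * (1 / (1 - Q ^ 2) ^ 2) +
        25 * L ^ 5 * (Q ^ (4 * j) / Q) * (1 + 1 / b) * (1 / (1 - Q ^ 2))) +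
        Q ^ (8 * j) + 20002 * (L ^ 2)⁻¹) ≤
      2 * (500050 + 4201 * ((Nat.factorial 25 : ℝ) * 18 ^ 25)) * (M ^ 4)⁻¹ := by
  obtain ⟨hδ, hδ'⟩ := inv_one_sub_exp_sq_le hM hb0 hb hQ
  have hpi := Real.pi_gt_three
  have hM0 : 0 < M := by linarith
  set C := (Nat.factorial 25 : ℝ) * 18 ^ 25 with hC
  have hC0 : 0 < C := by positivity
  set X := Real.exp (-(M ^ 2 / 18)) with hX
  have hXM : X ≤ C * (M ^ 50)⁻¹ := by
    rw [← div_eq_mul_inv, le_div_iff₀ (by positivity)]; exact exp_neg_sq_mul_pow_le M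
  have hpow : ∀ m : ℕ, 4 ≤ m → (M ^ m)⁻¹ ≤ (M ^ 4)⁻¹ := fun m hm ↦
    inv_anti₀ (by positivity) (pow_le_pow_right₀ hM hm)
  have hQ0 : 0 < Q := hQ ▸ Real.exp_pos _
  have hdecay : M ^ 2 / 18 ≤ Real.pi * b * (L / 4) := by
    have h1 : M ^ 2 ≤ 13 * b * L := by
      calc M ^ 2 = 1 * M ^ 2 := by ring
        _ ≤ 13 * b * M ^ 5 * M ^ 2 := by gcongr
        _ = 13 * b * L := by rw [hLM]; ring
    have h3 : 3.14 * (b * L) ≤ Real.pi * (b * L) := by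
      have := Real.pi_gt_d2
      have : 0 < b * L := by positivity
      gcongr
    nlinarith
  have hQ4 : Q ^ (4 * j) / Q ≤ X := by
    rw [hQ, ← Real.exp_nat_mul, ← Real.exp_sub, hX, Real.exp_le_exp]
    have h1 : L / 4 ≤ 4 * j - 1 := by linarith
    have h2 : Real.pi * b * (L / 4) ≤ Real.pi * b * (4 * j - 1) := by gcongr
    push_cast
    linarith
  have hQ8 : Q ^ (8 * j) ≤ X := by
    rw [hQ, ← Real.exp_nat_mul, hX, Real.exp_le_exp]
    have h1 : L / 4 ≤ 8 * j := by linarith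
    have h2 : Real.pi * b * (L / 4) ≤ Real.pi * b * (8 * j) := by gcongr
    push_cast
    linarith
  have hb1 : 1 + 1 / b ≤ 14 * M ^ 5 := by
    have : 1 / b ≤ 13 * M ^ 5 := by rw [div_le_iff₀ hb0]; linarith
    have := one_le_pow₀ hM (n := 5)
    linarith
  have hL2 : (L ^ 2)⁻¹ = (M ^ 14)⁻¹ := by rw [hLM, ← pow_mul]
  have t1 : 10001 * (L ^ 2)⁻¹ * (1 / (1 - Q ^ 2) ^ 2) ≤ 160016 * (M ^ 4)⁻¹ := by
    have : 1 / (1 - Q ^ 2) ^ 2 ≤ (4 * M ^ 5) ^ 2 := by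
      rw [← one_div_pow]; gcongr
    calc _ ≤ 10001 * (M ^ 14)⁻¹ * (4 * M ^ 5) ^ 2 := by rw [hL2]; gcongr
      _ = _ := by field_simp; ring
  have t2 : 25 * L ^ 5 * (Q ^ (4 * j) / Q) * (1 + 1 / b) * (1 / (1 - Q ^ 2)) ≤
      1400 * C * (M ^ 4)⁻¹ := by
    calc _ ≤ 25 * L ^ 5 * (C * (M ^ 50)⁻¹) * (14 * M ^ 5) * (4 * M ^ 5) := by
          have := hQ4.trans hXM
          gcongr
      _ = 1400 * C * (M ^ 5)⁻¹ := by rw [hLM]; field_simp; ring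
      _ ≤ _ := by gcongr; norm_num
  have t3 : Q ^ (8 * j) ≤ C * (M ^ 4)⁻¹ :=
    hQ8.trans (hXM.trans (by gcongr; norm_num))
  have t4 : (L ^ 2)⁻¹ ≤ (M ^ 4)⁻¹ := by rw [hL2]; exact hpow 14 (by norm_num)
  linarith

/-- The role of the exponent 3/7. If t ≤ 1 - σ, then a ≤ 3b and b is bounded below. Otherwise n² ≤
t, so M^30 = n^{6/7} ≤ t^{3/7} ≤ 4πab ≤ 13 M^35 b. -/
theorem one_le_mul_im {a b n t M : ℝ} (hM : 1 ≤ M) (hb : 0 < b) (hba : b ≤ a)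
    (hn : n = M ^ 35) (hn2 : n ^ 2 = a ^ 2 + b ^ 2) (htab : t = 2 * Real.pi * (a ^ 2 - b ^ 2))
    (ht : 1 ≤ t) (hσ : t ^ (3 / 7 : ℝ) ≤ 4 * Real.pi * (a * b)) : 1 ≤ 13 * b * M ^ 5 := by
  have hpi := Real.pi_gt_three
  have hpi' := Real.pi_lt_d2
  have hM0 : 0 < M := by linarith
  have hn1 : 1 ≤ n := hn ▸ one_le_pow₀ hM
  have hM5 : 1 ≤ M ^ 5 := one_le_pow₀ hM
  have ha : 0 < a := hb.trans_le hba
  by_cases hc : t ≤ 4 * Real.pi * (a * b)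
  · have h1 : a ^ 2 - b ^ 2 ≤ 2 * (a * b) := by
      rw [htab] at hc
      have : 2 * Real.pi * (a ^ 2 - b ^ 2) ≤ 2 * Real.pi * (2 * (a * b)) := by linarith
      exact le_of_mul_le_mul_left this (by positivity)
    have h2 : a ≤ 3 * b := by nlinarith
    have h3 : 1 ≤ 13 * b := by nlinarith
    nlinarith
  · push Not at hc
    have h1 : 2 * (a * b) ≤ a ^ 2 - b ^ 2 := by
      rw [htab] at hc
      have : 2 * Real.pi * (2 * (a * b)) ≤ 2 * Real.pi * (a ^ 2 - b ^ 2) := by linarith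
      exact le_of_mul_le_mul_left this (by positivity)
    have h2 : 2 * b ≤ a := by nlinarith
    have h3 : n ^ 2 ≤ t := by
      rw [htab, hn2]
      have : 0 ≤ a ^ 2 - b ^ 2 := by nlinarith
      nlinarith
    have h4 : M ^ 30 ≤ t ^ (3 / 7 : ℝ) := by
      calc M ^ 30 = ((n ^ 2 : ℝ)) ^ (3 / 7 : ℝ) := by
            rw [hn, ← pow_mul, ← Real.rpow_natCast, ← Real.rpow_natCast, ← Real.rpow_mul hM0.le]
            norm_num
        _ ≤ _ := by gcongr
    have h5 : a ≤ M ^ 35 := by rw [← hn]; nlinarith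
    have h6 : M ^ 30 * 1 ≤ M ^ 30 * (13 * b * M ^ 5) := by
      calc M ^ 30 * 1 ≤ 4 * Real.pi * (a * b) := by linarith
        _ ≤ 13 * (M ^ 35 * b) := by gcongr; linarith
        _ = _ := by ring
    exact le_of_mul_le_mul_left h6 (by positivity)

end RiemannAux

theorem mainTheorem1 :
    ∃ A t₀ : ℝ, 1 < t₀ ∧
      ∀ s ∈ RiemannAux.Omega t₀,
        ∃ U : ℂ, RiemannAux.R s = RiemannAux.mainTerm s * (1 + U) ∧
          ‖U‖ ≤ A * s.im ^ (-(1 / 21) : ℝ) := by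
  -- The value 10^31 ensures |η| ≥ 10^15, that is L = |η|^{1/5} ≥ 1000; the factor 7 comes from t ≤
  -- 7|η|².
  refine ⟨7 * (2 * (500050 + 4201 * ((Nat.factorial 25 : ℝ) * 18 ^ 25))), 10 ^ 31, by norm_num,
    fun s hs ↦ ?_⟩
  obtain ⟨ht, hσ⟩ := hs
  have hpi := Real.pi_gt_three
  have hpi' := Real.pi_lt_d2
  have ht1 : 1 ≤ s.im := le_trans (by norm_num) ht
  have ht0 : 0 < s.im := by linarith
  have hσ8 : 8 ≤ 1 - s.re := by
    refine le_trans ?_ hσ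
    calc (8 : ℝ) = (2 ^ 7 : ℝ) ^ (3 / 7 : ℝ) := by
          rw [← Real.rpow_natCast, ← Real.rpow_mul (by norm_num)]; norm_num
      _ ≤ _ := by gcongr; exact le_trans (by norm_num) ht
  have hσ1 : s.re < 1 := by linarith
  obtain ⟨hb0, hba, hs⟩ := RiemannAux.eta_facts hσ1 ht0
  have hre : 1 - s.re = 4 * Real.pi * ((RiemannAux.eta s).re * (RiemannAux.eta s).im) := by
    rw [congrArg Complex.re hs, RiemannAux.re_one_add_two_pi_I_mul]; ring
  have him : s.im = 2 * Real.pi * ((RiemannAux.eta s).re ^ 2 - (RiemannAux.eta s).im ^ 2) := by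
    have := congrArg Complex.im hs
    simp [pow_two] at this
    linear_combination this
  have hn2 : ‖RiemannAux.eta s‖ ^ 2 = (RiemannAux.eta s).re ^ 2 + (RiemannAux.eta s).im ^ 2 := by
    rw [← Complex.normSq_eq_norm_sq, Complex.normSq_apply]; ring
  have ht2 : s.im ≤ 7 * ‖RiemannAux.eta s‖ ^ 2 := by
    rw [hn2, him]
    nlinarith [sq_nonneg (RiemannAux.eta s).re, sq_nonneg (RiemannAux.eta s).im]
  have hn : 10 ^ 15 ≤ ‖RiemannAux.eta s‖ := by
    refine le_of_sq_le_sq ?_ (norm_nonneg _)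
    nlinarith
  have hn0 := norm_nonneg (RiemannAux.eta s)
  obtain ⟨M, hM, hnM⟩ : ∃ M : ℝ, 1 ≤ M ∧ ‖RiemannAux.eta s‖ = M ^ 35 :=
    ⟨‖RiemannAux.eta s‖ ^ (1 / 35 : ℝ), Real.one_le_rpow (le_trans (by norm_num) hn) (by norm_num), by
      rw [← Real.rpow_natCast, ← Real.rpow_mul hn0]; norm_num⟩
  have hM0 : 0 < M := by linarith
  have hL : (1000 : ℝ) ≤ M ^ 7 := by
    refine le_of_pow_le_pow_left₀ (n := 5) (by norm_num) (by positivity) ?_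
    rw [← pow_mul, ← hnM]
    exact le_trans (by norm_num) hn
  have hb : 1 ≤ 13 * (RiemannAux.eta s).im * M ^ 5 :=
    RiemannAux.one_le_mul_im hM hb0 hba hnM hn2 him ht1 (by rw [← hre]; exact hσ)
  -- The choice j = ⌊L/8⌋ uses nearly all the frequencies c ≤ L that the saddle point formula
  -- allows.
  have hj1 : 8 * (⌊M ^ 7 / 8⌋₊ : ℝ) ≤ M ^ 7 := by
    have := Nat.floor_le (show 0 ≤ M ^ 7 / 8 by positivity)
    linarith
  have hj2 : M ^ 7 - 8 ≤ 8 * (⌊M ^ 7 / 8⌋₊ : ℝ) := by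
    have := Nat.lt_floor_add_one (M ^ 7 / 8)
    linarith
  obtain ⟨U, hU, hUn⟩ := RiemannAux.exists_rel_error hσ1 ht0 hL (by rw [hnM, ← pow_mul])
    (by linarith) hj1 rfl
  refine ⟨U, hU, hUn.trans ((RiemannAux.rel_error_le hM rfl hL hb0 hb hj2 rfl).trans ?_)⟩
  -- There is slack here: t ≤ 7 M^70, whereas M^84 would suffice for the exponent 1/21.
  have hpow : s.im ^ (1 / 21 : ℝ) ≤ 7 * M ^ 4 := by
    calc s.im ^ (1 / 21 : ℝ) ≤ ((7 * M ^ 4) ^ 21) ^ (1 / 21 : ℝ) := by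
          refine Real.rpow_le_rpow ht0.le (ht2.trans ?_) (by norm_num)
          calc 7 * ‖RiemannAux.eta s‖ ^ 2 = 7 * M ^ 70 := by rw [hnM]; ring
            _ ≤ 7 ^ 21 * M ^ 84 := by
              gcongr
              · norm_num
              · norm_num
            _ = (7 * M ^ 4) ^ 21 := by ring
      _ = 7 * M ^ 4 := by
          rw [← Real.rpow_natCast, ← Real.rpow_mul (by positivity)]; norm_num
  have hMt : (M ^ 4)⁻¹ ≤ 7 * s.im ^ (-(1 / 21) : ℝ) := by
    rw [Real.rpow_neg ht0.le, ← div_eq_mul_inv, inv_eq_one_div,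
      div_le_div_iff₀ (by positivity) (by positivity)]
    linarith
  calc _ ≤ 2 * (500050 + 4201 * ((Nat.factorial 25 : ℝ) * 18 ^ 25)) *
        (7 * s.im ^ (-(1 / 21) : ℝ)) := by gcongr
    _ = _ := by ring
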